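/- Let $k$ be a field, $Q$ a finite quiver and $\Lambda=kQ/\mathcal J$ a gentle algebra: $\mathcal J$ is an admissible ideal generated by paths of length $2$; each vertex is the head of at most two and the tail of at most two arrows; and for each arrow $y$ there is at most one arrow $x$ with $xy$ a path in $\mathcal J$, at most one with $xy$ a path not in $\mathcal J$, at most one arrow $z$ with $yz$ a path in $\mathcal J$, and at most one with $yz$ a path not in $\mathcal J$. (Here $ba$ means first $a$, then $b$; $h$ and $t$ denote head and tail.) Let $\mathbf P$ be the set of non-trivial paths not in $\mathcal J$; $\gamma\in\mathbf P$ has a first arrow $\mathrm f(\gamma)$ and a last arrow $\mathrm l(\gamma)$. Put $h(\alpha^{-1})=t(\alpha)$ for an arrow $\alpha$, and fix signs $s(\alpha^{\pm1})\in\{\pm1\}$ such that distinct symbols $l,l'$ of the form $\alpha$ or $\alpha^{-1}$ with the same head have the same sign if and only if $\{l,l'\}=\{\alpha^{-1},\beta\}$ with $\alpha\beta\in\mathcal J$. *Words.* A generalised letter is $[\gamma]$ or $[\gamma^{-1}]$ with $\gamma\in\mathbf P$; $h([\gamma])=t(\gamma)=t([\gamma^{-1}])$, $t([\gamma])=h(\gamma)=h([\gamma^{-1}])$,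 $s([\gamma])=s(\mathrm f(\gamma)^{-1})$, $s([\gamma^{-1}])=-s(\mathrm l(\gamma))$. In a generalised word consecutive letters must be $[\gamma][\lambda^{-1}]$ with $h(\gamma)=h(\lambda)$, $\mathrm l(\gamma)\ne\mathrm l(\lambda)$; $[\gamma^{-1}][\lambda^{-1}]$ with $t(\gamma)=h(\lambda)$, $\mathrm f(\gamma)\mathrm l(\lambda)\in\mathcal J$; $[\gamma^{-1}][\lambda]$ with $t(\gamma)=t(\lambda)$, $\mathrm f(\gamma)\neq\mathrm f(\lambda)$; or $[\gamma][\lambda]$ with $h(\gamma)=t(\lambda)$, $\mathrm f(\lambda)\mathrm l(\gamma)\in\mathcal J$. There are also trivial words $1_{v,\pm1}$ for each vertex $v$, with $1_{v,\delta}^{-1}=1_{v,-\delta}$, head $v$ and sign $\delta$; head and sign of a non-trivial word are those of its first letter, and words $D$, $E$ compose to a word $DE$ if and only if $h(D^{-1})=h(E)$ and $s(D^{-1})=-s(E)$. Let $C=l_1^{-1}r_1\cdots l_t^{-1}r_t$ be a finite homotopy word of head $v$ and sign $\delta$: each $l_i^{-1}r_i$ is $\gamma^{-1}d_{\mathrm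 l(\gamma)}$ or $d_{\mathrm l(\gamma)}^{-1}\gamma$ with $\gamma\in\mathbf P$, and replacing these pairs by $[\gamma]$ or $[\gamma^{-1}]$ respectively gives a generalised word $[C]$ (for $t=0$, $C=1_{v,\delta}$). Let $C(\searrow)$ be obtained from $C$ by appending the longest possible (perhaps empty or infinite) sequence $[\gamma_1^{-1}][\gamma_2^{-1}]\cdots$ with all $\gamma_i$ arrows, and let $C(\swarrow\searrow)$ be obtained from $C(\searrow)$ by prepending the longest possible sequence $\cdots[\alpha_2][\alpha_1]$ with all $\alpha_i$ arrows. Index the places of $C(\swarrow\searrow)$ by an interval $I\subseteq\mathbb Z$ such that the place $0$ is where $C$ begins and $[C_i]$ lies between the places $i-1$ and $i$; let $v(i)$ be the vertex at the place $i$ (so $v(i-1)=h([C_i])$, $v(i)=t([C_i])$, $v(0)=v$). *Complexes.* $P=P(C(\swarrow\searrow))$ is the complex with $P^n=\bigoplus_{\mu(i)=n}\Lambda e_{v(i)}$, with $b_i$ the copy of $e_{v(i)}$, where $\mu(0)=0$ and $\mu(i)-\mu(i-1)$ is $-1$ if $[C_i]=[\gamma]$ and $1$ if $[C_i]=[\gamma^{-1}]$;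 its differential is $b_i\mapsto b_i^-+b_i^+$, where $b_i^+=\alpha b_{i+1}$ if $[C_{i+1}]=[\alpha^{-1}]$ and $b_i^-=\beta b_{i-1}$ if $[C_i]=[\beta]$, and these are $0$ otherwise. Let $E=1_{v,\delta}(\swarrow\searrow)$. The compact morphism $a\langle C\rangle:P(E)\to P(C(\swarrow\searrow))$ is the identity if $E=C(\swarrow\searrow)$. Otherwise $C(\searrow)=B\,l^{-1}r\,D$ where $B$ consists of $q\ge0$ pairs of the form $d_\alpha^{-1}\alpha$ with $\alpha$ an arrow and $l^{-1}r$ is not of this form; then $b_i\mapsto b_i$ for $i\le q$; $b_{q+1}\mapsto\lambda b_{q+1}$ if $l^{-1}r=d_{\mathrm l(\gamma)}^{-1}\gamma$ with $\gamma=\mathrm l(\gamma)\lambda$; and all other $b_i\mapsto0$. *Subspaces.* Let $M$ be a homotopically minimal complex of projective left $\Lambda$-modules, that is, $\mathrm{im}(d_M^n)\subseteq\mathrm{rad}(M^{n+1})$ for all $n$. Also write $M$ for $\bigoplus_iM^i$ and $d_M$ for its differential. For an arrow $\alpha$ let $d_{\alpha,M}:e_{h(\alpha)}M\to e_{h(\alpha)}M$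 be given by $d_{\alpha,M}(m)=\alpha m_\alpha$, where $d_M(m)=\sum_\beta\beta m_\beta$ over the arrows $\beta$ with head $h(\alpha)$ (this is well defined). Let $CM$ be the set of all $m\in e_vM$ for which there are $m=m_0,m_1,\dots,m_t$ with $m_i\in e_{v(i)}M$ and, for $1\le i\le t$, $\gamma m_{i-1}=d_{\mathrm l(\gamma),M}(m_i)$ if $l_i^{-1}r_i=\gamma^{-1}d_{\mathrm l(\gamma)}$ and $d_{\mathrm l(\gamma),M}(m_{i-1})=\gamma m_i$ if $l_i^{-1}r_i=d_{\mathrm l(\gamma)}^{-1}\gamma$. *Claim.* Let $r\in\mathbb Z$, let $[r]$ be the shift moving degree $0$ to degree $r$, and let $a=a\langle C\rangle[r]:P(E)[r]\to P(C(\swarrow\searrow))[r]$. Let $Ma$ be the set of morphisms of complexes $P(E)[r]\to M$ of the form $fa$, where $f:P(C(\swarrow\searrow))[r]\to M$ is a morphism of complexes. Then $$e_vM^r\cap CM=\{g(b_0)\mid g\in Ma\},$$ where $b_0\in P(E)[r]$ is the basis element of degree $r$ at the place $0$. Moreover the set of homotopy classes of the elements of $Ma$ is the pp-definable subgroup of $M$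 given by (the class of) $a$, namely the set of all morphisms in the homotopy category of the form $\phi a$ with $\phi:P(C(\swarrow\searrow))[r]\to M$. -/

import Mathlib

open CategoryTheory
open scoped DirectSum

universe u

noncomputable section

/-! ### Quivers with relations, path algebras, gentle algebras -/

/-- A quiver with vertices `V`, arrows `A`, head and tail maps `hd`, `tl`, together with a set
`rel` of paths of length `2`: the pair `(x, y)` stands for the path `x y` (first `y`, then `x`). -/
structure QuiverRel (V A : Type u) where
  hd : A → V
  tl : A → V
  rel : Set (A × A)
  rel_path : ∀ p ∈ rel, tl p.1 = hd p.2

namespace QuiverRel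

variable {V A : Type u} (Q : QuiverRel V A) (k : Type u) [Field k] [Fintype V]

/-- The defining relations of the path algebra on the generators `e_v` (`v` a vertex) and `a`
(`a` an arrow); `b * a` is the path "first `a`, then `b`". -/
inductive PathRel : FreeAlgebra k (V ⊕ A) → FreeAlgebra k (V ⊕ A) → Prop
  | idem (v : V) : PathRel (FreeAlgebra.ι k (Sum.inl v) * FreeAlgebra.ι k (Sum.inl v))
      (FreeAlgebra.ι k (Sum.inl v))
  | orth (v w : V) (hvw : v ≠ w) :
      PathRel (FreeAlgebra.ι k (Sum.inl v) * FreeAlgebra.ι k (Sum.inl w)) 0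
  | unit : PathRel (∑ v : V, FreeAlgebra.ι k (Sum.inl v)) 1
  | head (a : A) : PathRel (FreeAlgebra.ι k (Sum.inl (Q.hd a)) * FreeAlgebra.ι k (Sum.inr a))
      (FreeAlgebra.ι k (Sum.inr a))
  | tail (a : A) : PathRel (FreeAlgebra.ι k (Sum.inr a) * FreeAlgebra.ι k (Sum.inl (Q.tl a)))
      (FreeAlgebra.ι k (Sum.inr a))

/-- The path algebra `kQ`, by generators and relations. -/
abbrev PathAlgebra : Type u := RingQuot (Q.PathRel k)

/-- The trivial path `e_v` in `kQ`. -/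
def triv (v : V) : Q.PathAlgebra k :=
  RingQuot.mkAlgHom k (Q.PathRel k) (FreeAlgebra.ι k (Sum.inl v))

/-- The arrow `a` in `kQ`. -/
def arrow (a : A) : Q.PathAlgebra k :=
  RingQuot.mkAlgHom k (Q.PathRel k) (FreeAlgebra.ι k (Sum.inr a))

/-- The product `x₁ ⋯ xₘ` in `kQ` of a list of arrows. -/
def pathProd (p : List A) : Q.PathAlgebra k := (p.map (Q.arrow k)).prod

/-- The list of arrows `x₁, …, xₘ` is a path `x₁ ⋯ xₘ`: the tail of `xᵢ` is the head of `xᵢ₊₁`. -/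
def IsPath (p : List A) : Prop := p.IsChain (fun x y => Q.tl x = Q.hd y)

/-- The two-sided ideal `𝓙` of `kQ` generated by the given paths of length `2`. -/
def ideal : TwoSidedIdeal (Q.PathAlgebra k) :=
  TwoSidedIdeal.span {z | ∃ p ∈ Q.rel, z = Q.arrow k p.1 * Q.arrow k p.2}

/-- `kQ/𝓙` is a gentle algebra. As `𝓙` is generated by paths of length `2` it is contained in the
square of the arrow ideal, so that admissibility says that all long enough paths lie in `𝓙`. -/
structure IsGentle : Prop where
  admissible : ∃ N : ℕ, 2 ≤ N ∧
    ∀ p : List A, Q.IsPath p → p.length = N → Q.pathProd k p ∈ Q.ideal k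
  out_le : ∀ v : V, {a : A | Q.tl a = v}.encard ≤ 2
  in_le : ∀ v : V, {a : A | Q.hd a = v}.encard ≤ 2
  left_mem : ∀ y : A, {x : A | Q.tl x = Q.hd y ∧ Q.arrow k x * Q.arrow k y ∈ Q.ideal k}.encard ≤ 1
  right_mem : ∀ y : A, {z : A | Q.hd z = Q.tl y ∧ Q.arrow k y * Q.arrow k z ∈ Q.ideal k}.encard ≤ 1
  left_not_mem : ∀ y : A,
    {x : A | Q.tl x = Q.hd y ∧ Q.arrow k x * Q.arrow k y ∉ Q.ideal k}.encard ≤ 1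
  right_not_mem : ∀ y : A,
    {z : A | Q.hd z = Q.tl y ∧ Q.arrow k y * Q.arrow k z ∉ Q.ideal k}.encard ≤ 1

/-- The head of a symbol `α` (`Sum.inl α`) or `α⁻¹` (`Sum.inr α`). -/
def symHd : A ⊕ A → V
  | Sum.inl a => Q.hd a
  | Sum.inr a => Q.tl a

/-- A choice of signs for the symbols `α`, `α⁻¹`: distinct symbols with the same head have the same
sign if and only if they are `α⁻¹` and `β` with `α β ∈ 𝓙`. -/
def IsSign (s : A ⊕ A → ℤˣ) : Prop :=
  ∀ l l' : A ⊕ A, l ≠ l' → Q.symHd l = Q.symHd l' →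
    (s l = s l' ↔ ∃ α β : A, Q.arrow k α * Q.arrow k β ∈ Q.ideal k ∧
      ((l = Sum.inr α ∧ l' = Sum.inl β) ∨ (l = Sum.inl β ∧ l' = Sum.inr α)))

end QuiverRel

/-- A gentle algebra `kQ/𝓙` (with `Q` a finite quiver), and a choice of signs. -/
structure GentleData (k V A : Type u) [Field k] [Fintype V] [Fintype A] where
  Q : QuiverRel V A
  gentle : Q.IsGentle k
  sign : A ⊕ A → ℤˣ
  isSign : Q.IsSign k sign

namespace GentleData

variable {k V A : Type u} [Field k] [Fintype V] [Fintype A] (G : GentleData k V A)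

/-- The gentle algebra `Λ = kQ/𝓙`. -/
abbrev Alg : Type u := (G.Q.ideal k).ringCon.Quotient

/-- The quotient map `kQ → Λ`. -/
def proj : G.Q.PathAlgebra k →+* G.Alg := (G.Q.ideal k).ringCon.mk'

/-- `e_v` in `Λ`. -/
def e (v : V) : G.Alg := G.proj (G.Q.triv k v)

/-- The coset of an arrow in `Λ`. -/
def ar (a : A) : G.Alg := G.proj (G.Q.arrow k a)

/-- The coset of the product of a list of arrows in `Λ`. -/
def word (p : List A) : G.Alg := G.proj (G.Q.pathProd k p)

/-- The set `𝐏` of non-trivial paths which do not lie in `𝓙`. -/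
structure NzPath where
  arrows : List A
  ne_nil : arrows ≠ []
  isPath : G.Q.IsPath arrows
  not_mem : G.Q.pathProd k arrows ∉ G.Q.ideal k

namespace NzPath

variable {G}

/-- The last arrow `l(γ)`. -/
def last (γ : G.NzPath) : A := γ.arrows.head γ.ne_nil

/-- The first arrow `f(γ)`. -/
def first (γ : G.NzPath) : A := γ.arrows.getLast γ.ne_nil

/-- The head `h(γ)`. -/
def hd (γ : G.NzPath) : V := G.Q.hd γ.last

/-- The tail `t(γ)`. -/
def tl (γ : G.NzPath) : V := G.Q.tl γ.first

/-- The element of `Λ` given by `γ`. -/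
def val (γ : G.NzPath) : G.Alg := G.word γ.arrows

/-- The element of `Λ` given by `λ`, where `γ = l(γ) λ`. -/
def rest (γ : G.NzPath) : G.Alg := G.word γ.arrows.tail

/-- `γ` is an arrow. -/
def IsArrow (γ : G.NzPath) : Prop := γ.arrows.length = 1

end NzPath

/-! ### Letters and words -/

/-- The generalised letters: `dir γ` is `[γ]` and `inv γ` is `[γ⁻¹]`. In the language of homotopy
words `dir γ` is the pair of homotopy letters `l⁻¹ r = γ⁻¹ d_{l(γ)}`, and `inv γ` is the pair
`l⁻¹ r = d_{l(γ)}⁻¹ γ`. -/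
inductive Letter
  | dir (γ : G.NzPath)
  | inv (γ : G.NzPath)

namespace Letter

variable {G}

/-- Head of a letter: `h([γ]) = t(γ)` and `h([γ⁻¹]) = h(γ)`. -/
def hd : G.Letter → V
  | dir γ => γ.tl
  | inv γ => γ.hd

/-- Tail of a letter: `t([γ]) = h(γ)` and `t([γ⁻¹]) = t(γ)`. -/
def tl : G.Letter → V
  | dir γ => γ.hd
  | inv γ => γ.tl

/-- The inverse letter. -/
def flip : G.Letter → G.Letter
  | dir γ => inv γ
  | inv γ => dir γ

/-- `s([γ]) = s(f(γ)⁻¹)` and `s([γ⁻¹]) = -s(l(γ))`. -/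
def sgn : G.Letter → ℤˣ
  | dir γ => G.sign (Sum.inr γ.first)
  | inv γ => - G.sign (Sum.inl γ.last)

/-- `H[γ] = -1` and `H[γ⁻¹] = 1`. -/
def deg : G.Letter → ℤ
  | dir _ => -1
  | inv _ => 1

/-- `[C_i][C_{i+1}]` may occur in a generalised word. -/
def Adj : G.Letter → G.Letter → Prop
  | dir γ, inv μ => γ.hd = μ.hd ∧ γ.last ≠ μ.last
  | inv γ, inv μ => γ.tl = μ.hd ∧ G.Q.arrow k γ.first * G.Q.arrow k μ.last ∈ G.Q.ideal k
  | inv γ, dir μ => γ.tl = μ.tl ∧ γ.first ≠ μ.first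
  | dir γ, dir μ => γ.hd = μ.tl ∧ G.Q.arrow k μ.first * G.Q.arrow k γ.last ∈ G.Q.ideal k

/-- The letter is `[α]` for an arrow `α`. -/
def IsDirArrow : G.Letter → Prop
  | dir γ => γ.IsArrow
  | inv _ => False

/-- The letter is `[α⁻¹]` for an arrow `α` (that is, the pair `d_α⁻¹ α`). -/
def IsInvArrow : G.Letter → Prop
  | dir _ => False
  | inv γ => γ.IsArrow

theorem neg_units_iff {a b : ℤˣ} : a = -b ↔ a ≠ b := by
  rcases Int.units_eq_one_or a with rfl | rfl <;> rcases Int.units_eq_one_or b with rfl | rfl <;>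
    decide

theorem sign_hd_eq {a b : A} (h : G.Q.hd a = G.Q.hd b)
    (hs : G.sign (Sum.inl a) = G.sign (Sum.inl b)) : a = b := by
  by_contra hab
  obtain ⟨α, β, -, h1 | h1⟩ := (G.isSign (Sum.inl a) (Sum.inl b) (by simpa using hab) h).1 hs
  · exact absurd h1.1 (by simp)
  · exact absurd h1.2 (by simp)

theorem sign_tl_eq {a b : A} (h : G.Q.tl a = G.Q.tl b)
    (hs : G.sign (Sum.inr a) = G.sign (Sum.inr b)) : a = b := by
  by_contra hab
  obtain ⟨α, β, -, h1 | h1⟩ := (G.isSign (Sum.inr a) (Sum.inr b) (by simpa using hab) h).1 hs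
  · exact absurd h1.2 (by simp)
  · exact absurd h1.1 (by simp)

theorem sign_mixed {a b : A} (h : G.Q.tl a = G.Q.hd b) :
    G.sign (Sum.inr a) = G.sign (Sum.inl b) ↔ G.Q.arrow k a * G.Q.arrow k b ∈ G.Q.ideal k := by
  rw [G.isSign (Sum.inr a) (Sum.inl b) (by simp) h]
  constructor
  · rintro ⟨α, β, hm, ⟨h1, h2⟩ | ⟨h1, h2⟩⟩
    · cases h1; cases h2; exact hm
    · exact absurd h1 (by simp)
  · intro hm
    exact ⟨a, b, hm, Or.inl ⟨rfl, rfl⟩⟩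

/-- The composition of words is a word if and only if heads agree and signs are opposite. -/
theorem adj_iff (x y : G.Letter) : x.Adj y ↔ x.tl = y.hd ∧ y.sgn = - x.flip.sgn := by
  rcases x with γ | γ <;> rcases y with μ | μ
  · refine and_congr_right fun h => ?_
    simp only [flip, sgn, neg_neg]
    exact (sign_mixed (G := G) (a := μ.first) (b := γ.last) h.symm).symm
  · refine and_congr_right fun h => ?_
    simp only [flip, sgn, neg_neg]
    rw [← not_iff_not, not_not, neg_eq_iff_eq_neg, neg_units_iff, not_not]
    exact ⟨fun h' => by rw [h'], fun h' => (sign_hd_eq h.symm h').symm⟩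
  · refine and_congr_right fun h => ?_
    simp only [flip, sgn]
    rw [← not_iff_not, not_not, neg_units_iff, not_not]
    exact ⟨fun h' => by rw [h'], fun h' => (sign_tl_eq h.symm h').symm⟩
  · refine and_congr_right fun h => ?_
    simp only [flip, sgn, neg_inj]
    rw [eq_comm]
    exact (sign_mixed (G := G) (a := γ.first) (b := μ.last) h).symm

theorem Adj.tl_eq {x y : G.Letter} (h : x.Adj y) : x.tl = y.hd := ((adj_iff x y).1 h).1

end Letter

/-- The homotopy `{0, …, t}`-words with head `v` and sign `δ`, given by the list of their `t` pairs
of homotopy letters `lᵢ⁻¹ rᵢ`. The empty list is the trivial word `1_{v,δ}`. -/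
structure FinWord (v : V) (δ : ℤˣ) where
  letters : List G.Letter
  chain : letters.IsChain Letter.Adj
  start : ∀ x ∈ letters.head?, x.hd = v ∧ x.sgn = δ

/-- The trivial word `1_{v,δ}`. -/
def trivWord (v : V) (δ : ℤˣ) : G.FinWord v δ := ⟨[], List.isChain_nil, by simp⟩

/-- A generalised word, recorded with a base point: `letter i` is `[C_i]` and sits between the
places `i - 1` and `i`, the index set `I` is an interval of `ℤ` which contains the place `0`, and
`base` is the vertex at the place `0`. -/
structure GWord where
  base : V
  letter : ℤ → Option G.Letter
  adj : ∀ i x y, letter i = some x → letter (i + 1) = some y → x.Adj y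
  right_closed : ∀ i, 0 < i → letter i = none → letter (i + 1) = none
  left_closed : ∀ i, i ≤ 0 → letter i = none → letter (i - 1) = none
  base_hd : ∀ x, letter 1 = some x → x.hd = base
  base_tl : ∀ x, letter 0 = some x → x.tl = base

namespace GWord

variable {G} (C : G.GWord)

/-- The index set `I` of the word. -/
def index : Set ℤ := {i | (0 < i → (C.letter i).isSome) ∧ (i < 0 → (C.letter (i + 1)).isSome)}

/-- The vertex `v_C(i)` at the place `i ∈ I`. -/
def vert (i : ℤ) : V :=
  if 0 < i then ((C.letter i).map Letter.tl).getD C.base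
  else if i < 0 then ((C.letter (i + 1)).map Letter.hd).getD C.base
  else C.base

/-- `H[C_i]` (and `0` if there is no letter at `i`). -/
def letterDeg (i : ℤ) : ℤ := ((C.letter i).map Letter.deg).getD 0

/-- The degree function: `μ(0) = 0`, `μ(i) = H[C₁] + ⋯ + H[C_i]` for `i > 0` and
`μ(i) = -(H[C₀] + ⋯ + H[C_{i+1}])` for `i < 0`. -/
def mu (i : ℤ) : ℤ := ∑ j ∈ Finset.Ioc 0 i, C.letterDeg j - ∑ j ∈ Finset.Ioc i 0, C.letterDeg j

theorem mu_zero : C.mu 0 = 0 := by simp [mu]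

theorem mu_add_one (i : ℤ) : C.mu (i + 1) = C.mu i + C.letterDeg (i + 1) := by
  unfold mu
  rcases lt_or_ge i 0 with h | h
  · have h1 : Finset.Ioc 0 (i + 1) = ∅ := Finset.Ioc_eq_empty (by lia)
    have h2 : Finset.Ioc 0 i = ∅ := Finset.Ioc_eq_empty (by lia)
    have h3 : Finset.Ioc i 0 = insert (i + 1) (Finset.Ioc (i + 1) 0) := by
      ext j; simp only [Finset.mem_insert, Finset.mem_Ioc]; lia
    rw [h1, h2, h3, Finset.sum_insert (by simp)]
    simp
  · have h1 : Finset.Ioc (i + 1) 0 = ∅ := Finset.Ioc_eq_empty (by lia)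
    have h2 : Finset.Ioc i 0 = ∅ := Finset.Ioc_eq_empty (by lia)
    have h3 : Finset.Ioc 0 (i + 1) = insert (i + 1) (Finset.Ioc 0 i) := by
      ext j; simp only [Finset.mem_insert, Finset.mem_Ioc]; lia
    rw [h1, h2, h3, Finset.sum_insert (by simp)]
    simp [add_comm]

theorem isSome_of_le {i : ℤ} {x : G.Letter} (hx : C.letter i = some x) :
    ∀ j, i ≤ j → j ≤ 0 → ∃ y, C.letter j = some y := by
  intro j hij
  induction j, hij using Int.leInduction with
  | base => exact fun _ => ⟨x, hx⟩
  | succ n hn ih =>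
    intro h0
    obtain ⟨y, hy⟩ := ih (by lia)
    rcases hz : C.letter (n + 1) with _ | z
    · have := C.left_closed (n + 1) h0 hz
      simp [hy] at this
    · exact ⟨z, rfl⟩

theorem vert_of_letter {i : ℤ} {x : G.Letter} (hx : C.letter i = some x) :
    C.vert i = x.tl ∧ C.vert (i - 1) = x.hd ∧ i ∈ C.index ∧ i - 1 ∈ C.index := by
  refine ⟨?_, ?_, ⟨?_, ?_⟩, ⟨?_, ?_⟩⟩
  · rcases lt_trichotomy 0 i with h | h | h
    · simp [vert, h, hx]
    · subst h; simp [vert, C.base_tl x hx]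
    · obtain ⟨y, hy⟩ := C.isSome_of_le hx (i + 1) (by lia) (by lia)
      simp [vert, h, h.not_gt, hy, (C.adj i x y hx hy).tl_eq]
  · rcases lt_trichotomy 1 i with h | h | h
    · rcases hy : C.letter (i - 1) with _ | y
      · have := C.right_closed (i - 1) (by lia) hy
        simp [hx] at this
      · have := (C.adj (i - 1) y x hy (by simpa using hx)).tl_eq
        simp [vert, h, hy, this]
    · subst h; simp [vert, C.base_hd x hx]
    · simp [vert, show ¬ (1 < i) by lia, show i - 1 < 0 by lia, hx]
  · simp [hx]
  · intro h
    obtain ⟨y, hy⟩ := C.isSome_of_le hx (i + 1) (by lia) (by lia)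
    simp [hy]
  · intro h
    rcases hy : C.letter (i - 1) with _ | y
    · have := C.right_closed (i - 1) (by lia) hy
      simp [hx] at this
    · rfl
  · simp [hx]

/-! ### The complex of a word -/

/-- The basis element `b_i`, in the free `Λ`-module on the integers. -/
def b (i : ℤ) : ℤ →₀ G.Alg := Finsupp.single i (G.e (C.vert i))

/-- The degree `n` part `P^n(C) = ⊕ Λ b_i ≅ ⊕ Λ e_{v(i)}`, the sum over all `i ∈ I` with
`μ(i) = n`. -/
def piece (n : ℤ) : Submodule G.Alg (ℤ →₀ G.Alg) :=
  Submodule.span G.Alg {x | ∃ i ∈ C.index, C.mu i = n ∧ x = C.b i}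

/-- `b_i^+`. -/
def bPlus (i : ℤ) : ℤ →₀ G.Alg :=
  match C.letter (i + 1) with
  | some (Letter.inv α) => α.val • C.b (i + 1)
  | _ => 0

/-- `b_i^-`. -/
def bMinus (i : ℤ) : ℤ →₀ G.Alg :=
  match C.letter i with
  | some (Letter.dir β) => β.val • C.b (i - 1)
  | _ => 0

/-- The `Λ`-linear map with `b_i ↦ b_i^- + b_i^+`. -/
def diff : (ℤ →₀ G.Alg) →ₗ[G.Alg] (ℤ →₀ G.Alg) :=
  Finsupp.linearCombination G.Alg (fun i => C.bMinus i + C.bPlus i)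

end GWord

theorem triv_idem (v : V) : G.e v * G.e v = G.e v := by
  unfold e
  rw [← map_mul]
  congr 1
  unfold QuiverRel.triv
  rw [← map_mul]
  exact RingQuot.mkAlgHom_rel k (QuiverRel.PathRel.idem v)

theorem e_mul_ar (a : A) : G.e (G.Q.hd a) * G.ar a = G.ar a := by
  unfold e ar
  rw [← map_mul]
  congr 1
  unfold QuiverRel.triv QuiverRel.arrow
  rw [← map_mul]
  exact RingQuot.mkAlgHom_rel k (QuiverRel.PathRel.head a)

theorem word_cons (a : A) (p : List A) : G.word (a :: p) = G.ar a * G.word p := by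
  simp [word, ar, QuiverRel.pathProd]

theorem word_append (p q : List A) : G.word (p ++ q) = G.word p * G.word q := by
  simp [word, QuiverRel.pathProd]

theorem proj_eq_zero {z : G.Q.PathAlgebra k} (h : z ∈ G.Q.ideal k) : G.proj z = 0 := by
  have h1 : (G.Q.ideal k).ringCon z 0 := (TwoSidedIdeal.mem_iff _ _).1 h
  have h2 : G.proj z = G.proj 0 := (RingCon.eq _).2 h1
  simpa using h2

theorem ar_mul_ar {a c : A} (h : G.Q.arrow k a * G.Q.arrow k c ∈ G.Q.ideal k) :
    G.ar a * G.ar c = 0 := by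
  have := G.proj_eq_zero h
  rwa [map_mul] at this

theorem NzPath.val_eq (γ : G.NzPath) : γ.val = G.ar γ.last * γ.rest := by
  rcases γ with ⟨_ | ⟨a, p⟩, hne, hp, hn⟩
  · exact absurd rfl hne
  · exact G.word_cons a p

theorem NzPath.e_mul_val (γ : G.NzPath) : G.e γ.hd * γ.val = γ.val := by
  rw [NzPath.val_eq, ← mul_assoc]
  exact congrArg (· * γ.rest) (G.e_mul_ar γ.last)

theorem word_mul_eq_zero {p : List A} (hp : p ≠ []) {γ : G.NzPath}
    (h : G.Q.arrow k (p.getLast hp) * G.Q.arrow k γ.last ∈ G.Q.ideal k) :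
    G.word p * γ.val = 0 := by
  conv_lhs => rw [← List.dropLast_append_getLast hp, word_append, NzPath.val_eq, word_cons]
  have h0 : G.ar (p.getLast hp) * G.ar γ.last = 0 := G.ar_mul_ar h
  have h1 : G.word ([] : List A) = 1 := by simp [word, QuiverRel.pathProd]
  rw [h1, mul_one, mul_assoc, ← mul_assoc (G.ar _) (G.ar _), h0]
  simp

namespace GWord

variable {G} (C : G.GWord)

theorem bPlus_of {i : ℤ} {α : G.NzPath} (h : C.letter (i + 1) = some (Letter.inv α)) :
    C.bPlus i = α.val • C.b (i + 1) := by simp [bPlus, h]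

theorem bMinus_of {i : ℤ} {β : G.NzPath} (h : C.letter i = some (Letter.dir β)) :
    C.bMinus i = β.val • C.b (i - 1) := by simp [bMinus, h]

theorem bPlus_of_not {i : ℤ} (h : ∀ α, C.letter (i + 1) ≠ some (Letter.inv α)) :
    C.bPlus i = 0 := by
  unfold bPlus
  split
  · exact absurd ‹_› (h _)
  · rfl

theorem bMinus_of_not {i : ℤ} (h : ∀ β, C.letter i ≠ some (Letter.dir β)) :
    C.bMinus i = 0 := by
  unfold bMinus
  split
  · exact absurd ‹_› (h _)
  · rfl

theorem e_smul_bPlus (i : ℤ) : G.e (C.vert i) • C.bPlus i = C.bPlus i := by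
  by_cases h : ∃ α, C.letter (i + 1) = some (Letter.inv α)
  · obtain ⟨α, h⟩ := h
    have h1 := (C.vert_of_letter h).2.1
    rw [add_sub_cancel_right] at h1
    rw [C.bPlus_of h, h1, smul_smul]
    exact congrArg (· • C.b (i + 1)) α.e_mul_val
  · rw [C.bPlus_of_not (by simpa using h), smul_zero]

theorem e_smul_bMinus (i : ℤ) : G.e (C.vert i) • C.bMinus i = C.bMinus i := by
  by_cases h : ∃ α, C.letter i = some (Letter.dir α)
  · obtain ⟨α, h⟩ := h
    have h1 := (C.vert_of_letter h).1
    rw [C.bMinus_of h, h1, smul_smul]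
    exact congrArg (· • C.b (i - 1)) α.e_mul_val
  · rw [C.bMinus_of_not (by simpa using h), smul_zero]

theorem diff_b (i : ℤ) : C.diff (C.b i) = C.bMinus i + C.bPlus i := by
  simp only [diff, b, Finsupp.linearCombination_single, smul_add, e_smul_bPlus, e_smul_bMinus]

theorem b_mem {i n : ℤ} (hi : i ∈ C.index) (hn : C.mu i = n) : C.b i ∈ C.piece n :=
  Submodule.subset_span ⟨i, hi, hn, rfl⟩

theorem diff_b_mem {i n m : ℤ} (hn : C.mu i = n) (hm : n + 1 = m) :
    C.diff (C.b i) ∈ C.piece m := by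
  rw [diff_b]
  refine Submodule.add_mem _ ?_ ?_
  · by_cases h : ∃ α, C.letter i = some (Letter.dir α)
    · obtain ⟨α, h⟩ := h
      rw [C.bMinus_of h]
      refine Submodule.smul_mem _ _ (C.b_mem (C.vert_of_letter h).2.2.2 ?_)
      have h1 := C.mu_add_one (i - 1)
      rw [sub_add_cancel] at h1
      simp only [letterDeg, h, Option.map_some, Option.getD_some, Letter.deg] at h1
      lia
    · rw [C.bMinus_of_not (by simpa using h)]; exact Submodule.zero_mem _
  · by_cases h : ∃ α, C.letter (i + 1) = some (Letter.inv α)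
    · obtain ⟨α, h⟩ := h
      rw [C.bPlus_of h]
      refine Submodule.smul_mem _ _ (C.b_mem (C.vert_of_letter h).2.2.1 ?_)
      have h1 := C.mu_add_one i
      simp only [letterDeg, h, Option.map_some, Option.getD_some, Letter.deg] at h1
      lia
    · rw [C.bPlus_of_not (by simpa using h)]; exact Submodule.zero_mem _

theorem diff_mem {n m : ℤ} (hm : n + 1 = m) : ∀ x ∈ C.piece n, C.diff x ∈ C.piece m := by
  intro x hx
  have : C.piece n ≤ (C.piece m).comap C.diff := by
    refine Submodule.span_le.2 ?_
    rintro _ ⟨i, -, hn, rfl⟩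
    exact C.diff_b_mem hn hm
  exact this hx

theorem diff_diff_b (i : ℤ) : C.diff (C.diff (C.b i)) = 0 := by
  rw [diff_b, map_add]
  have h1 : C.diff (C.bMinus i) = 0 := by
    by_cases h : ∃ α, C.letter i = some (Letter.dir α)
    · obtain ⟨α, h⟩ := h
      rw [C.bMinus_of h, map_smul, diff_b, C.bPlus_of_not (by simp [h]), add_zero]
      by_cases h' : ∃ β, C.letter (i - 1) = some (Letter.dir β)
      · obtain ⟨β, h'⟩ := h'
        have hadj := C.adj (i - 1) _ _ h' (by simpa using h)
        rw [C.bMinus_of h', smul_smul]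
        have : α.val * β.val = 0 := G.word_mul_eq_zero α.ne_nil hadj.2
        rw [this, zero_smul]
      · rw [C.bMinus_of_not (by simpa using h'), smul_zero]
    · rw [C.bMinus_of_not (by simpa using h), map_zero]
  have h2 : C.diff (C.bPlus i) = 0 := by
    by_cases h : ∃ α, C.letter (i + 1) = some (Letter.inv α)
    · obtain ⟨α, h⟩ := h
      rw [C.bPlus_of h, map_smul, diff_b, C.bMinus_of_not (by simp [h]), zero_add]
      by_cases h' : ∃ β, C.letter (i + 1 + 1) = some (Letter.inv β)
      · obtain ⟨β, h'⟩ := h'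
        have hadj := C.adj (i + 1) _ _ h h'
        rw [C.bPlus_of h', smul_smul]
        have : α.val * β.val = 0 := G.word_mul_eq_zero α.ne_nil hadj.2
        rw [this, zero_smul]
      · rw [C.bPlus_of_not (by simpa using h'), smul_zero]
    · rw [C.bPlus_of_not (by simpa using h), map_zero]
  rw [h1, h2, add_zero]

theorem diff_diff {n : ℤ} : ∀ x ∈ C.piece n, C.diff (C.diff x) = 0 := by
  intro x hx
  have : C.piece n ≤ LinearMap.ker (C.diff ∘ₗ C.diff) := by
    refine Submodule.span_le.2 ?_
    rintro _ ⟨i, -, hn, rfl⟩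
    exact C.diff_diff_b i
  exact this hx

open Classical in
/-- The complex `P(C)`. -/
def complex : CochainComplex (ModuleCat.{u} G.Alg) ℤ where
  X n := ModuleCat.of G.Alg (C.piece n)
  d n m := if h : n + 1 = m then ModuleCat.ofHom (C.diff.restrict (C.diff_mem h)) else 0
  shape n m h := dif_neg h
  d_comp_d' n m l h h' := by
    have h1 : n + 1 = m := h
    have h2 : m + 1 = l := h'
    rw [dif_pos h1, dif_pos h2]
    refine ModuleCat.hom_ext (LinearMap.ext fun x => Subtype.ext ?_)
    exact C.diff_diff x.1 x.2

theorem zero_mem_index : (0 : ℤ) ∈ C.index := ⟨by simp, by simp⟩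

/-- The basis element `b_0` at the base point, in degree `0` of `P(C)`. -/
def bBase : C.complex.X 0 := (⟨C.b 0, C.b_mem C.zero_mem_index C.mu_zero⟩ : C.piece 0)

end GWord

/-! ### The word `C(↙↘)` -/

open Classical in
/-- A letter `[γ⁻¹]`, with `γ` an arrow, such that `x [γ⁻¹]` may occur in a word, if there is one. -/
def nextInv (x : G.Letter) : Option G.Letter :=
  if h : ∃ y : G.Letter, y.IsInvArrow ∧ x.Adj y then some h.choose else none

open Classical in
/-- A letter `[α]`, with `α` an arrow, such that `[α] x` may occur in a word, if there is one. -/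
def prevDir (x : G.Letter) : Option G.Letter :=
  if h : ∃ y : G.Letter, y.IsDirArrow ∧ y.Adj x then some h.choose else none

/-- Iterate a partial function. -/
def iterOpt {α : Type*} (f : α → Option α) (s : Option α) : ℕ → Option α
  | 0 => s
  | n + 1 => (iterOpt f s n).bind f

namespace FinWord

variable {G} {v : V} {δ : ℤˣ} (C : G.FinWord v δ)

/-- The end vertex `h(C⁻¹)`. -/
def endVert : V := (C.letters.getLast?.map Letter.tl).getD v

/-- The sign `s(C⁻¹)` of the inverse word; `1_{v,δ}⁻¹ = 1_{v,-δ}`. -/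
def endSgn : ℤˣ := (C.letters.getLast?.map (fun x => x.flip.sgn)).getD (-δ)

open Classical in
/-- A letter `[γ⁻¹]`, with `γ` an arrow, such that `C [γ⁻¹]` is a word, if there is one. -/
def startRight : Option G.Letter :=
  if h : ∃ y : G.Letter, y.IsInvArrow ∧ C.endVert = y.hd ∧ C.endSgn = - y.sgn
  then some h.choose else none

variable (G v δ) in
open Classical in
/-- A letter `[α]`, with `α` an arrow, such that `[α] C` is a word for a (equivalently, every) word
`C` of head `v` and sign `δ`, if there is one. -/
def startLeft : Option G.Letter :=
  if h : ∃ y : G.Letter, y.IsDirArrow ∧ y.tl = v ∧ y.flip.sgn = - δ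
  then some h.choose else none

/-- The letters of `C(↙↘)` to the right of the base point: those of `C`, followed by letters
`[γ₁⁻¹] [γ₂⁻¹] ⋯`, with `γᵢ` arrows, as long as this gives a word. As `Λ` is gentle the next letter
is unique in each step, so that this is the longest possible sequence. -/
def right (n : ℕ) : Option G.Letter :=
  if n < C.letters.length then C.letters[n]?
  else iterOpt G.nextInv C.startRight (n - C.letters.length)

variable (G v δ) in
/-- The letters `⋯ [α₂] [α₁]` of `C(↙↘)` to the left of the base point (from right to left), with
`αᵢ` arrows, as long as this gives a word. Again the next letter is unique in each step. -/
def left (n : ℕ) : Option G.Letter := iterOpt G.prevDir (startLeft G v δ) n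

/-- The letters of `C(↙↘)`; those of `C` are at `1, …, t`. -/
def extLetter (i : ℤ) : Option G.Letter :=
  if i ≤ 0 then left G v δ (-i).toNat else C.right (i - 1).toNat

end FinWord

namespace Letter

variable {G}

theorem invArrow_unique {x y : G.Letter} (hx : x.IsInvArrow) (hy : y.IsInvArrow)
    (h : x.hd = y.hd) (hs : x.sgn = y.sgn) : x = y := by
  rcases x with γ | γ
  · exact hx.elim
  rcases y with μ | μ
  · exact hy.elim
  have h1 : γ.last = μ.last := sign_hd_eq (G := G) h (neg_inj.1 hs)
  rcases γ with ⟨p, hp, _, _⟩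
  rcases μ with ⟨q, hq, _, _⟩
  obtain ⟨a, rfl⟩ := List.length_eq_one_iff.1 hx
  obtain ⟨b, rfl⟩ := List.length_eq_one_iff.1 hy
  have h2 : a = b := h1
  subst h2
  rfl

theorem flip_hd (x : G.Letter) : x.flip.hd = x.tl := by cases x <;> rfl

theorem isInvArrow_flip (x : G.Letter) : x.flip.IsInvArrow ↔ x.IsDirArrow := by
  cases x <;> rfl

theorem dirArrow_unique {x y : G.Letter} (hx : x.IsDirArrow) (hy : y.IsDirArrow)
    (h : x.tl = y.tl) (hs : x.flip.sgn = y.flip.sgn) : x = y := by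
  have h1 : x.flip = y.flip := invArrow_unique ((isInvArrow_flip x).2 hx)
    ((isInvArrow_flip y).2 hy) (by rw [flip_hd, flip_hd, h]) hs
  rcases x with γ | γ
  · rcases y with μ | μ
    · cases h1; rfl
    · exact hy.elim
  · exact hx.elim

end Letter

theorem nextInv_eq_some {x y : G.Letter} :
    G.nextInv x = some y ↔ y.IsInvArrow ∧ x.Adj y := by
  unfold nextInv
  constructor
  · intro h
    split at h
    · rename_i hex
      cases h
      exact hex.choose_spec
    · cases h
  · intro h
    have hex : ∃ y : G.Letter, y.IsInvArrow ∧ x.Adj y := ⟨y, h⟩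
    rw [dif_pos hex]
    have h1 := hex.choose_spec
    have h2 := (Letter.adj_iff _ _).1 h1.2
    have h3 := (Letter.adj_iff _ _).1 h.2
    exact congrArg some (Letter.invArrow_unique h1.1 h.1 (h2.1.symm.trans h3.1)
      (h2.2.trans h3.2.symm))

theorem prevDir_eq_some {x y : G.Letter} :
    G.prevDir x = some y ↔ y.IsDirArrow ∧ y.Adj x := by
  unfold prevDir
  constructor
  · intro h
    split at h
    · rename_i hex
      cases h
      exact hex.choose_spec
    · cases h
  · intro h
    have hex : ∃ y : G.Letter, y.IsDirArrow ∧ y.Adj x := ⟨y, h⟩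
    rw [dif_pos hex]
    have h1 := hex.choose_spec
    have h2 := (Letter.adj_iff _ _).1 h1.2
    have h3 := (Letter.adj_iff _ _).1 h.2
    exact congrArg some (Letter.dirArrow_unique h1.1 h.1 (h2.1.trans h3.1.symm)
      (neg_inj.1 (h2.2.symm.trans h3.2)))

theorem iterOpt_succ_eq_some {α : Type*} {f : α → Option α} {s : Option α} {n : ℕ} {y : α} :
    iterOpt f s (n + 1) = some y ↔ ∃ x, iterOpt f s n = some x ∧ f x = some y := by
  simp [iterOpt, Option.bind_eq_some_iff]

theorem iterOpt_succ_none {α : Type*} {f : α → Option α} {s : Option α} {n : ℕ}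
    (h : iterOpt f s n = none) : iterOpt f s (n + 1) = none := by
  simp [iterOpt, h]

namespace FinWord

variable {G} {v : V} {δ : ℤˣ} (C : G.FinWord v δ)

theorem startRight_eq_some {y : G.Letter} : C.startRight = some y ↔
    y.IsInvArrow ∧ C.endVert = y.hd ∧ C.endSgn = - y.sgn := by
  unfold startRight
  constructor
  · intro h
    split at h
    · rename_i hex
      cases h
      exact hex.choose_spec
    · cases h
  · intro h
    have hex : ∃ y : G.Letter, y.IsInvArrow ∧ C.endVert = y.hd ∧ C.endSgn = - y.sgn := ⟨y, h⟩
    rw [dif_pos hex]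
    have h1 := hex.choose_spec
    exact congrArg some (Letter.invArrow_unique h1.1 h.1 (h1.2.1.symm.trans h.2.1)
      (neg_inj.1 (h1.2.2.symm.trans h.2.2)))

theorem startLeft_eq_some {y : G.Letter} : startLeft G v δ = some y ↔
    y.IsDirArrow ∧ y.tl = v ∧ y.flip.sgn = - δ := by
  unfold startLeft
  constructor
  · intro h
    split at h
    · rename_i hex
      cases h
      exact hex.choose_spec
    · cases h
  · intro h
    have hex : ∃ y : G.Letter, y.IsDirArrow ∧ y.tl = v ∧ y.flip.sgn = - δ := ⟨y, h⟩
    rw [dif_pos hex]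
    have h1 := hex.choose_spec
    exact congrArg some (Letter.dirArrow_unique h1.1 h.1 (h1.2.1.trans h.2.1.symm)
      (h1.2.2.trans h.2.2.symm))

theorem right_of_lt {n : ℕ} (h : n < C.letters.length) : C.right n = some C.letters[n] := by
  simp [right, h]

theorem right_of_ge {n : ℕ} (h : C.letters.length ≤ n) :
    C.right n = iterOpt G.nextInv C.startRight (n - C.letters.length) := by
  simp [right, h.not_gt]

theorem right_closed {n : ℕ} (h : C.right n = none) : C.right (n + 1) = none := by
  rcases lt_or_ge n C.letters.length with hn | hn
  · rw [C.right_of_lt hn] at h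
    cases h
  · rw [C.right_of_ge hn] at h
    rw [C.right_of_ge (by lia), Nat.sub_add_comm hn]
    exact iterOpt_succ_none h

theorem right_zero {y : G.Letter} (h : C.right 0 = some y) : y.hd = v ∧ y.sgn = δ := by
  rcases C with ⟨_ | ⟨x, L⟩, hc, hs⟩
  · rw [right_of_ge _ (by simp)] at h
    have h1 := (startRight_eq_some _).1 h
    refine ⟨?_, ?_⟩
    · simpa [endVert] using h1.2.1.symm
    · simpa [endSgn] using h1.2.2.symm
  · rw [right_of_lt _ (by simp)] at h
    cases h
    exact hs _ rfl

theorem right_adj {n : ℕ} {x y : G.Letter} (hx : C.right n = some x)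
    (hy : C.right (n + 1) = some y) : x.Adj y := by
  rcases lt_trichotomy (n + 1) C.letters.length with hn | hn | hn
  · rw [C.right_of_lt (by lia)] at hx
    rw [C.right_of_lt hn] at hy
    cases hx; cases hy
    exact List.isChain_iff_getElem.1 C.chain n hn
  · rw [C.right_of_lt (by lia)] at hx
    rw [C.right_of_ge hn.ge, hn, Nat.sub_self] at hy
    have h1 := C.startRight_eq_some.1 hy
    have h2 : C.letters.getLast? = some x := by
      rw [List.getLast?_eq_getElem?, ← hn, Nat.add_sub_cancel,
        List.getElem?_eq_getElem (by lia)]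
      exact hx
    simp only [endVert, endSgn, h2, Option.map_some, Option.getD_some] at h1
    rw [Letter.adj_iff]
    exact ⟨h1.2.1, by rw [h1.2.2, neg_neg]⟩
  · rw [C.right_of_ge (by lia)] at hx
    rw [C.right_of_ge hn.le, Nat.sub_add_comm (by lia)] at hy
    obtain ⟨z, hz, hzy⟩ := iterOpt_succ_eq_some.1 hy
    rw [hx] at hz
    cases hz
    exact (G.nextInv_eq_some.1 hzy).2

theorem extLetter_of_le {i : ℤ} (h : i ≤ 0) : C.extLetter i = left G v δ (-i).toNat := by
  simp [extLetter, h]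

theorem extLetter_of_pos {i : ℤ} (h : 0 < i) : C.extLetter i = C.right (i - 1).toNat := by
  simp [extLetter, h.not_ge]

/-- The word `C(↙↘)`, with base point at the place where `C` begins. -/
def ext : G.GWord where
  base := v
  letter := C.extLetter
  adj i x y hx hy := by
    rcases lt_trichotomy i 0 with h | h | h
    · rw [C.extLetter_of_le h.le, show (-i).toNat = (-(i + 1)).toNat + 1 by lia] at hx
      rw [C.extLetter_of_le (by lia)] at hy
      obtain ⟨z, hz, hzx⟩ := iterOpt_succ_eq_some.1 hx
      have h1 : some y = some z := hy.symm.trans hz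
      cases h1
      exact (G.prevDir_eq_some.1 hzx).2
    · subst h
      rw [C.extLetter_of_le le_rfl] at hx
      rw [C.extLetter_of_pos (by lia)] at hy
      have h1 := C.right_zero hy
      have h2 := startLeft_eq_some.1 hx
      rw [Letter.adj_iff, h1.1, h1.2, h2.2.1, h2.2.2, neg_neg]
      exact ⟨rfl, rfl⟩
    · rw [C.extLetter_of_pos h] at hx
      rw [C.extLetter_of_pos (by lia), show (i + 1 - 1).toNat = (i - 1).toNat + 1 by lia] at hy
      exact C.right_adj hx hy
  right_closed i hi h := by
    rw [C.extLetter_of_pos hi] at h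
    rw [C.extLetter_of_pos (by lia), show (i + 1 - 1).toNat = (i - 1).toNat + 1 by lia]
    exact C.right_closed h
  left_closed i hi h := by
    rw [C.extLetter_of_le hi] at h
    rw [C.extLetter_of_le (by lia), show (-(i - 1)).toNat = (-i).toNat + 1 by lia]
    exact iterOpt_succ_none h
  base_hd x hx := by
    rw [C.extLetter_of_pos (by lia)] at hx
    exact (C.right_zero hx).1
  base_tl x hx := by
    rw [C.extLetter_of_le le_rfl] at hx
    exact (startLeft_eq_some.1 hx).2.1

end FinWord

/-! ### The morphism `a⟨C⟩` -/

theorem NzPath.ext_arrows {γ μ : G.NzPath} (h : γ.arrows = μ.arrows) : γ = μ := by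
  cases γ; cases μ; cases h; rfl

/-- The arrow `l(γ)` again lies in `𝐏`. -/
theorem NzPath.exists_last (γ : G.NzPath) : ∃ μ : G.NzPath, μ.arrows = [γ.last] := by
  refine ⟨⟨[γ.last], by simp, List.isChain_singleton _, ?_⟩, rfl⟩
  intro hm
  apply γ.not_mem
  have h1 : γ.arrows = [γ.last] ++ γ.arrows.tail := (List.cons_head_tail γ.ne_nil).symm
  have h2 : G.Q.pathProd k γ.arrows =
      G.Q.pathProd k [γ.last] * G.Q.pathProd k γ.arrows.tail := by
    conv_lhs => rw [h1]
    simp [QuiverRel.pathProd]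
  rw [h2]
  exact TwoSidedIdeal.mul_mem_right _ _ _ hm

theorem e_mul_word {p : List A} (hp : p ≠ []) :
    G.e (G.Q.hd (p.head hp)) * G.word p = G.word p := by
  rcases p with _ | ⟨a, p⟩
  · exact absurd rfl hp
  · rw [word_cons, ← mul_assoc]
    exact congrArg (· * G.word p) (G.e_mul_ar a)

theorem NzPath.e_mul_rest (γ : G.NzPath) (h : ¬ γ.IsArrow) :
    G.e (G.Q.tl γ.last) * γ.rest = γ.rest := by
  rcases γ with ⟨_ | ⟨a, _ | ⟨c, p⟩⟩, hne, hp, hn⟩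
  · exact absurd rfl hne
  · exact absurd rfl h
  · have h1 : G.Q.tl a = G.Q.hd c := (List.isChain_cons_cons.1 hp).1
    have h2 : G.e (G.Q.hd c) * G.word (c :: p) = G.word (c :: p) :=
      G.e_mul_word (p := c :: p) (by simp)
    change G.e (G.Q.tl a) * G.word (c :: p) = G.word (c :: p)
    rw [h1, h2]

theorem NzPath.rest_mul (γ μ : G.NzPath) (h : ¬ γ.IsArrow)
    (hm : G.Q.arrow k γ.first * G.Q.arrow k μ.last ∈ G.Q.ideal k) : γ.rest * μ.val = 0 := by
  rcases γ with ⟨_ | ⟨a, _ | ⟨c, p⟩⟩, hne, hp, hn⟩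
  · exact absurd rfl hne
  · exact absurd rfl h
  · exact G.word_mul_eq_zero (p := c :: p) (by simp) hm

namespace FinWord

variable {G} {v : V} {δ : ℤˣ} (C : G.FinWord v δ)

/-- All letters `[C_1], …, [C_i]` of `C(↙↘)` are inverses of arrows (and `i ∈ I`). In the notation
where `C(↘) = B l⁻¹ r D`, with `B` the longest initial part consisting of `q` pairs of the form
`d_α⁻¹ α`, this says that `i ≤ q`. -/
def Flat (i : ℤ) : Prop :=
  i ∈ C.ext.index ∧ ∀ j, 0 < j → j ≤ i → ∃ x, C.ext.letter j = some x ∧ x.IsInvArrow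

open Classical in
/-- The image of `b_i` under `a⟨C⟩ : P(1_{v,δ}(↙↘)) → P(C(↙↘))`: it is `b_i` for `i ≤ q`, it is
`λ b_{q+1}` if `i = q + 1` and `l⁻¹ r = d_{l(γ)}⁻¹ γ` with `γ = l(γ) λ`, and it is `0` otherwise.
If `C(↙↘) = 1_{v,δ}(↙↘)` then every `b_i` is mapped to `b_i`. -/
def aVal (i : ℤ) : ℤ →₀ G.Alg :=
  if C.Flat i then C.ext.b i
  else if 0 < i ∧ C.Flat (i - 1) then
    match C.ext.letter i with
    | some (Letter.inv γ) => γ.rest • C.ext.b i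
    | _ => 0
  else 0

/-- The `Λ`-linear map underlying `a⟨C⟩`. -/
def aLin : (ℤ →₀ G.Alg) →ₗ[G.Alg] (ℤ →₀ G.Alg) := Finsupp.linearCombination G.Alg C.aVal

/-- The word `1_{v,δ}(↙↘)`. -/
abbrev triv (G : GentleData k V A) (v : V) (δ : ℤˣ) : G.GWord := (G.trivWord v δ).ext

theorem triv_right (n : ℕ) : (G.trivWord v δ).right n =
    iterOpt G.nextInv (G.trivWord v δ).startRight n := by
  rw [right_of_ge _ (Nat.zero_le _)]
  rfl

theorem triv_start {y : G.Letter} :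
    (G.trivWord v δ).startRight = some y ↔ y.IsInvArrow ∧ y.hd = v ∧ y.sgn = δ := by
  rw [startRight_eq_some]
  simp only [endVert, endSgn, trivWord, List.getLast?_nil, Option.map_none, Option.getD_none,
    neg_inj]
  exact and_congr_right fun _ => ⟨fun h => ⟨h.1.symm, h.2.symm⟩, fun h => ⟨h.1.symm, h.2.symm⟩⟩

theorem triv_letter_pos {i : ℤ} (hi : 0 < i) {x : G.Letter}
    (hx : (triv G v δ).letter i = some x) : x.IsInvArrow := by
  change (G.trivWord v δ).extLetter i = some x at hx
  rw [extLetter_of_pos _ hi, triv_right] at hx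
  rcases hn : (i - 1).toNat with _ | n
  · rw [hn] at hx
    exact (triv_start.1 hx).1
  · rw [hn] at hx
    obtain ⟨z, -, hz⟩ := iterOpt_succ_eq_some.1 hx
    exact (G.nextInv_eq_some.1 hz).1

theorem triv_letter_le {i : ℤ} (hi : i ≤ 0) {x : G.Letter}
    (hx : (triv G v δ).letter i = some x) : x.IsDirArrow := by
  change (G.trivWord v δ).extLetter i = some x at hx
  rw [extLetter_of_le _ hi, left] at hx
  rcases hn : (-i).toNat with _ | n
  · rw [hn] at hx
    exact (startLeft_eq_some.1 hx).1
  · rw [hn] at hx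
    obtain ⟨z, -, hz⟩ := iterOpt_succ_eq_some.1 hx
    exact (G.prevDir_eq_some.1 hz).1

theorem letter_le {i : ℤ} (hi : i ≤ 0) : (triv G v δ).letter i = C.ext.letter i := by
  change (G.trivWord v δ).extLetter i = C.extLetter i
  rw [extLetter_of_le _ hi, extLetter_of_le _ hi]

theorem triv_letter_next {i : ℤ} (hi : 0 < i)
    (hprev : (triv G v δ).letter (i - 1) = C.ext.letter (i - 1)) {γ : G.NzPath}
    (hγ : C.ext.letter i = some (Letter.inv γ)) :
    ∃ μ : G.NzPath, μ.arrows = [γ.last] ∧ (triv G v δ).letter i = some (Letter.inv μ) := by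
  obtain ⟨μ, hμ⟩ := γ.exists_last
  refine ⟨μ, hμ, ?_⟩
  have hlast : μ.last = γ.last := by simp [NzPath.last, hμ]
  have harr : (Letter.inv μ).IsInvArrow := by simp [Letter.IsInvArrow, NzPath.IsArrow, hμ]
  have hhd : (Letter.inv μ).hd = (Letter.inv γ).hd := by simp [Letter.hd, NzPath.hd, hlast]
  have hsg : (Letter.inv μ).sgn = (Letter.inv γ).sgn := by simp [Letter.sgn, hlast]
  change (G.trivWord v δ).extLetter i = _
  change (G.trivWord v δ).extLetter (i - 1) = C.extLetter (i - 1) at hprev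
  change C.extLetter i = _ at hγ
  rw [extLetter_of_pos _ hi] at hγ ⊢
  rw [triv_right]
  rcases hn : (i - 1).toNat with _ | n
  · rw [hn] at hγ
    have h1 := C.right_zero hγ
    exact triv_start.2 ⟨harr, hhd.trans h1.1, hsg.trans h1.2⟩
  · rw [hn] at hγ
    rw [extLetter_of_pos _ (by lia), extLetter_of_pos _ (by lia), triv_right,
      show (i - 1 - 1).toNat = n by lia] at hprev
    rcases hx : C.right n with _ | x
    · rw [C.right_closed hx] at hγ
      cases hγ
    · rw [hx] at hprev
      refine iterOpt_succ_eq_some.2 ⟨x, hprev, G.nextInv_eq_some.2 ⟨harr, ?_⟩⟩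
      have h1 := (Letter.adj_iff _ _).1 (C.right_adj hx hγ)
      exact (Letter.adj_iff _ _).2 ⟨h1.1.trans hhd.symm, hsg.trans h1.2⟩

theorem letter_eq_of_flat {i : ℤ} (hi : C.Flat i) :
    ∀ j, j ≤ max i 0 → (triv G v δ).letter j = C.ext.letter j := by
  intro j hj
  rcases le_or_gt j 0 with h0 | h0
  · exact C.letter_le h0
  · have h1 : 0 ≤ j := h0.le
    clear h0
    induction j, h1 using Int.leInduction with
    | base => exact C.letter_le le_rfl
    | succ n hn ih =>
      have ih' := ih (by lia)
      obtain ⟨x, hx, hxa⟩ := hi.2 (n + 1) (by lia) (by lia)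
      rcases x with γ | γ
      · exact hxa.elim
      · obtain ⟨μ, hμ, hl⟩ := C.triv_letter_next (i := n + 1) (by lia)
          (by rw [add_sub_cancel_right]; exact ih') hx
        rw [hl, hx]
        have : μ = γ := NzPath.ext_arrows (G := G) <| by
          obtain ⟨a, ha⟩ := List.length_eq_one_iff.1 hxa
          rw [hμ, ha]
          simp [NzPath.last, ha]
        rw [this]

theorem mu_eq_of_flat {i : ℤ} (hi : C.Flat i) : (triv G v δ).mu i = C.ext.mu i := by
  unfold GWord.mu
  congr 1
  · refine Finset.sum_congr rfl fun j hj => ?_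
    rw [Finset.mem_Ioc] at hj
    rw [GWord.letterDeg, GWord.letterDeg, C.letter_eq_of_flat hi j (by lia)]
  · refine Finset.sum_congr rfl fun j hj => ?_
    rw [Finset.mem_Ioc] at hj
    rw [GWord.letterDeg, GWord.letterDeg, C.letter_eq_of_flat hi j (by lia)]

theorem vert_eq_of_flat {i : ℤ} (hi : C.Flat i) : (triv G v δ).vert i = C.ext.vert i := by
  unfold GWord.vert
  rw [C.letter_eq_of_flat hi i (by lia)]
  rcases lt_or_ge i 0 with h | h
  · rw [C.letter_eq_of_flat hi (i + 1) (by lia)]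
    rfl
  · simp only [h.not_gt, if_false]
    rfl

theorem flat_of_le {i : ℤ} (hi : i ≤ 0) (hmem : i ∈ (triv G v δ).index) : C.Flat i := by
  refine ⟨⟨fun h => absurd h hi.not_gt, fun h => ?_⟩, fun j h1 h2 => by lia⟩
  have := hmem.2 h
  rwa [C.letter_le (by lia)] at this

theorem aVal_flat {i : ℤ} (h : C.Flat i) : C.aVal i = C.ext.b i := by simp [aVal, h]

theorem aVal_next {i : ℤ} (h : ¬ C.Flat i) (h0 : 0 < i) (h1 : C.Flat (i - 1)) {γ : G.NzPath}
    (hγ : C.ext.letter i = some (Letter.inv γ)) : C.aVal i = γ.rest • C.ext.b i := by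
  simp [aVal, h, h0, h1, hγ]

theorem aVal_zero {i : ℤ} (h : ¬ C.Flat i)
    (h1 : 0 < i → C.Flat (i - 1) → ∀ γ, C.ext.letter i ≠ some (Letter.inv γ)) :
    C.aVal i = 0 := by
  unfold aVal
  rw [if_neg h]
  split
  · rename_i h2
    split
    · exact absurd ‹_› (h1 h2.1 h2.2 _)
    · rfl
  · rfl

theorem not_arrow_of_not_flat {i : ℤ} (h : ¬ C.Flat i) (h1 : C.Flat (i - 1)) {γ : G.NzPath}
    (hγ : C.ext.letter i = some (Letter.inv γ)) : ¬ γ.IsArrow := by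
  intro ha
  refine h ⟨(C.ext.vert_of_letter hγ).2.2.1, fun j h2 h3 => ?_⟩
  rcases h3.lt_or_eq with h4 | rfl
  · exact h1.2 j h2 (by lia)
  · exact ⟨_, hγ, ha⟩

theorem e_smul_aVal (i : ℤ) : G.e ((triv G v δ).vert i) • C.aVal i = C.aVal i := by
  by_cases h : C.Flat i
  · rw [C.aVal_flat h, C.vert_eq_of_flat h, GWord.b, Finsupp.smul_single, smul_eq_mul, triv_idem]
  · by_cases h1 : 0 < i ∧ C.Flat (i - 1) ∧ ∃ γ, C.ext.letter i = some (Letter.inv γ)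
    · obtain ⟨h0, h1, γ, hγ⟩ := h1
      obtain ⟨μ, hμ, hl⟩ := C.triv_letter_next h0
        (C.letter_eq_of_flat h1 (i - 1) (by lia)) hγ
      have hv := ((triv G v δ).vert_of_letter hl).1
      have hv' : (Letter.inv μ : G.Letter).tl = G.Q.tl γ.last := by
        simp [Letter.tl, NzPath.tl, NzPath.first, hμ]
      rw [C.aVal_next h h0 h1 hγ, hv, hv', smul_smul,
        NzPath.e_mul_rest G γ (C.not_arrow_of_not_flat h h1 hγ)]
    · rw [C.aVal_zero h fun h2 h3 γ hγ => h1 ⟨h2, h3, γ, hγ⟩, smul_zero]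

theorem aLin_b (i : ℤ) : C.aLin ((triv G v δ).b i) = C.aVal i := by
  rw [aLin, GWord.b, Finsupp.linearCombination_single, e_smul_aVal]

theorem aVal_mem {i n : ℤ} (hn : (triv G v δ).mu i = n) : C.aVal i ∈ C.ext.piece n := by
  by_cases h : C.Flat i
  · rw [C.aVal_flat h]
    exact C.ext.b_mem h.1 (by rw [← C.mu_eq_of_flat h, hn])
  · by_cases h1 : 0 < i ∧ C.Flat (i - 1) ∧ ∃ γ, C.ext.letter i = some (Letter.inv γ)
    · obtain ⟨h0, h1, γ, hγ⟩ := h1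
      obtain ⟨μ, hμ, hl⟩ := C.triv_letter_next h0
        (C.letter_eq_of_flat h1 (i - 1) (by lia)) hγ
      rw [C.aVal_next h h0 h1 hγ]
      refine Submodule.smul_mem _ _ (C.ext.b_mem (C.ext.vert_of_letter hγ).2.2.1 ?_)
      have h3 := C.ext.mu_add_one (i - 1)
      have h4 := (triv G v δ).mu_add_one (i - 1)
      rw [sub_add_cancel] at h3 h4
      rw [← hn, h3, h4, C.mu_eq_of_flat h1]
      simp [GWord.letterDeg, hγ, hl, Letter.deg]
    · rw [C.aVal_zero h fun h2 h3 γ hγ => h1 ⟨h2, h3, γ, hγ⟩]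
      exact Submodule.zero_mem _

theorem aLin_mem {n : ℤ} : ∀ x ∈ (triv G v δ).piece n, C.aLin x ∈ C.ext.piece n := by
  intro x hx
  have : (triv G v δ).piece n ≤ (C.ext.piece n).comap C.aLin := by
    refine Submodule.span_le.2 ?_
    rintro _ ⟨i, -, hn, rfl⟩
    change C.aLin _ ∈ C.ext.piece n
    rw [aLin_b]
    exact C.aVal_mem hn
  exact this hx

theorem flat_pred {i : ℤ} (h0 : 0 < i) (h : C.Flat i) : C.Flat (i - 1) := by
  obtain ⟨x, hx, -⟩ := h.2 i h0 le_rfl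
  exact ⟨(C.ext.vert_of_letter hx).2.2.2, fun j h1 h2 => h.2 j h1 (by lia)⟩

theorem aLin_bMinus {i : ℤ} (h : C.Flat i) :
    C.aLin ((triv G v δ).bMinus i) = C.ext.bMinus i := by
  have hl := C.letter_eq_of_flat h i (by lia)
  by_cases hd : ∃ β, C.ext.letter i = some (Letter.dir β)
  · obtain ⟨β, hβ⟩ := hd
    have hβ' := hl.trans hβ
    have h0 : i ≤ 0 := by
      by_contra h0
      exact triv_letter_pos (by lia) hβ'
    rw [C.ext.bMinus_of hβ, (triv G v δ).bMinus_of hβ', map_smul, aLin_b, C.aVal_flat]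
    exact C.flat_of_le (by lia) ((triv G v δ).vert_of_letter hβ').2.2.2
  · have hd' : ∀ β, C.ext.letter i ≠ some (Letter.dir β) := by simpa using hd
    rw [C.ext.bMinus_of_not hd', (triv G v δ).bMinus_of_not (by rw [hl]; exact hd'), map_zero]

theorem aLin_bPlus {i : ℤ} (h : C.Flat i) :
    C.aLin ((triv G v δ).bPlus i) = C.ext.bPlus i := by
  rcases lt_or_ge i 0 with hi | hi
  · have hl := C.letter_eq_of_flat h (i + 1) (by lia)
    have hd : ∀ β, (triv G v δ).letter (i + 1) ≠ some (Letter.inv β) := fun β hβ =>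
      triv_letter_le (by lia) hβ
    rw [C.ext.bPlus_of_not (by rw [← hl]; exact hd), (triv G v δ).bPlus_of_not hd, map_zero]
  · have hpred : (triv G v δ).letter (i + 1 - 1) = C.ext.letter (i + 1 - 1) :=
      C.letter_eq_of_flat h _ (by lia)
    by_cases hd : ∃ γ, C.ext.letter (i + 1) = some (Letter.inv γ)
    · obtain ⟨γ, hγ⟩ := hd
      obtain ⟨μ, hμ, hl⟩ := C.triv_letter_next (by lia) hpred hγ
      rw [C.ext.bPlus_of hγ, (triv G v δ).bPlus_of hl, map_smul, aLin_b]
      have hval : μ.val = G.ar γ.last := by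
        simp [NzPath.val, hμ, word, QuiverRel.pathProd, ar]
      by_cases hf : C.Flat (i + 1)
      · have h2 := C.letter_eq_of_flat hf (i + 1) (by lia)
        rw [hl, hγ] at h2
        cases h2
        rw [C.aVal_flat hf]
      · rw [C.aVal_next hf (by lia) (by rwa [add_sub_cancel_right]) hγ, smul_smul, hval,
          ← NzPath.val_eq]
    · have hd' : ∀ γ, C.ext.letter (i + 1) ≠ some (Letter.inv γ) := by simpa using hd
      rw [C.ext.bPlus_of_not hd']
      have hf : ¬ C.Flat (i + 1) := by
        intro hf
        obtain ⟨x, hx, hxa⟩ := hf.2 (i + 1) (by lia) le_rfl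
        rcases x with γ | γ
        · exact hxa
        · exact hd' γ hx
      by_cases ht : ∃ γ, (triv G v δ).letter (i + 1) = some (Letter.inv γ)
      · obtain ⟨γ, hγ⟩ := ht
        rw [(triv G v δ).bPlus_of hγ, map_smul, aLin_b, C.aVal_zero hf fun _ _ => hd', smul_zero]
      · rw [(triv G v δ).bPlus_of_not (by simpa using ht), map_zero]

theorem aLin_diff_b {i : ℤ} (hi : i ∈ (triv G v δ).index) :
    C.aLin ((triv G v δ).diff ((triv G v δ).b i)) = C.ext.diff (C.aLin ((triv G v δ).b i)) := by
  rw [GWord.diff_b, map_add, aLin_b]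
  by_cases h : C.Flat i
  · rw [C.aVal_flat h, GWord.diff_b, C.aLin_bMinus h, C.aLin_bPlus h]
  · have h0 : 0 < i := by
      by_contra h0
      exact h (C.flat_of_le (by lia) hi)
    have hm : (triv G v δ).bMinus i = 0 := (triv G v δ).bMinus_of_not fun β hβ =>
      triv_letter_pos h0 hβ
    have hp : C.aLin ((triv G v δ).bPlus i) = 0 := by
      by_cases ht : ∃ γ, (triv G v δ).letter (i + 1) = some (Letter.inv γ)
      · obtain ⟨γ, hγ⟩ := ht
        have hf : ¬ C.Flat (i + 1) := fun hf => h (by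
          have := C.flat_pred (by lia) hf
          rwa [add_sub_cancel_right] at this)
        rw [(triv G v δ).bPlus_of hγ, map_smul, aLin_b, C.aVal_zero hf, smul_zero]
        intro _ h2
        rw [add_sub_cancel_right] at h2
        exact absurd h2 h
      · rw [(triv G v δ).bPlus_of_not (by simpa using ht), map_zero]
    rw [hm, hp, map_zero, zero_add]
    by_cases h1 : C.Flat (i - 1) ∧ ∃ γ, C.ext.letter i = some (Letter.inv γ)
    · obtain ⟨h1, γ, hγ⟩ := h1
      rw [C.aVal_next h h0 h1 hγ, map_smul, GWord.diff_b,
        C.ext.bMinus_of_not (by simp [hγ]), zero_add]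
      by_cases h2 : ∃ μ, C.ext.letter (i + 1) = some (Letter.inv μ)
      · obtain ⟨μ, hμ⟩ := h2
        have hadj := C.ext.adj i _ _ hγ hμ
        rw [C.ext.bPlus_of hμ, smul_smul,
          NzPath.rest_mul G γ μ (C.not_arrow_of_not_flat h h1 hγ) hadj.2, zero_smul]
      · rw [C.ext.bPlus_of_not (by simpa using h2), smul_zero]
    · rw [C.aVal_zero h fun _ h3 γ hγ => h1 ⟨h3, γ, hγ⟩, map_zero]

theorem aLin_diff {n : ℤ} : ∀ x ∈ (triv G v δ).piece n,
    C.aLin ((triv G v δ).diff x) = C.ext.diff (C.aLin x) := by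
  intro x hx
  have : (triv G v δ).piece n ≤
      LinearMap.eqLocus (C.aLin ∘ₗ (triv G v δ).diff) (C.ext.diff ∘ₗ C.aLin) := by
    refine Submodule.span_le.2 ?_
    rintro _ ⟨i, hi, -, rfl⟩
    exact C.aLin_diff_b hi
  exact this hx

/-- The morphism of complexes `a⟨C⟩ : P(1_{v,δ}(↙↘)) ⟶ P(C(↙↘))`. -/
def compactMap : (triv G v δ).complex ⟶ C.ext.complex where
  f n := ModuleCat.ofHom (C.aLin.restrict C.aLin_mem)
  comm' n m h := by
    have h1 : n + 1 = m := h
    simp only [GWord.complex, dif_pos h1]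
    refine ModuleCat.hom_ext (LinearMap.ext fun x => Subtype.ext ?_)
    exact (C.aLin_diff x.1 x.2).symm

end FinWord

/-! ### The subspaces `C M` of a complex `M` -/

variable {G}

section Subspaces

variable (M : CochainComplex (ModuleCat.{u} G.Alg) ℤ)

/-- The `Λ`-module `⊕ M^i`. -/
abbrev Total : Type u := ⨁ i : ℤ, M.X i

/-- The endomorphism `d_M` of `⊕ M^i`. -/
def totalD : Total M →ₗ[G.Alg] Total M :=
  DirectSum.toModule G.Alg ℤ (Total M) fun i =>
    (DirectSum.lof G.Alg ℤ (fun i => M.X i) (i + 1)).comp (M.d i (i + 1)).hom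

/-- `e_v M`. -/
def vertexPart (v : V) : Set (Total M) := {m | G.e v • m = m}

open Classical in
/-- `d_{α,M}(m) = y`, for `m ∈ e_{h(α)} M`: there is an expression `d_M(m) = ∑ β m_β`, over the
arrows `β` with head `h(α)`, with `y = α m_α`. (For `M` homotopically minimal with projective terms
there is exactly one such `y`, as `e_v rad(M)` is the direct sum of the subspaces `β M`.) -/
def IsArrowD (α : A) (m y : Total M) : Prop :=
  m ∈ vertexPart M (G.Q.hd α) ∧ ∃ c : A → Total M,
    totalD M m = ∑ β ∈ Finset.univ.filter (fun β => G.Q.hd β = G.Q.hd α), G.ar β • c β ∧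
    y = G.ar α • c α

/-- `γ U`. -/
def pathImage (γ : G.NzPath) (U : Set (Total M)) : Set (Total M) := {x | ∃ m ∈ U, x = γ.val • m}

/-- `γ⁻¹ U`. -/
def pathPreimage (γ : G.NzPath) (U : Set (Total M)) : Set (Total M) :=
  {m | m ∈ vertexPart M γ.tl ∧ γ.val • m ∈ U}

/-- `d_α U`. -/
def dImage (α : A) (U : Set (Total M)) : Set (Total M) := {y | ∃ m ∈ U, IsArrowD M α m y}

/-- `d_α⁻¹ U`. -/
def dPreimage (α : A) (U : Set (Total M)) : Set (Total M) :=
  {m | m ∈ vertexPart M (G.Q.hd α) ∧ ∃ y ∈ U, IsArrowD M α m y}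

/-- `l⁻¹ r U` for a pair `l⁻¹ r` of homotopy letters. -/
def Letter.act : G.Letter → Set (Total M) → Set (Total M)
  | .dir γ, U => pathPreimage M γ (dImage M γ.last U)
  | .inv γ, U => dPreimage M γ.last (pathImage M γ U)

/-- `C M = l₁⁻¹ r₁ ⋯ l_t⁻¹ r_t e_u M`, where `u` is the end vertex of `C`. -/
def FinWord.act {v : V} {δ : ℤˣ} (C : G.FinWord v δ) : Set (Total M) :=
  C.letters.foldr (fun x U => x.act M U) (vertexPart M C.endVert)

/-- `M` is a homotopically minimal complex of projective `Λ`-modules. -/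
structure IsMinimalProj : Prop where
  projective : ∀ n, Module.Projective G.Alg (M.X n)
  minimal : ∀ n, LinearMap.range (M.d n (n + 1)).hom ≤ Module.jacobson G.Alg (M.X (n + 1))

end Subspaces

/-- The subgroup `M a = {f a ∣ f : Y ⟶ M}` of `X ⟶ M`, for a morphism `a : X ⟶ Y`. -/
def ppSubgroup {T : Type*} [Category T] [Preadditive T] {X Y : T} (a : X ⟶ Y) (M : T) :
    AddSubgroup (X ⟶ M) :=
  (Preadditive.leftComp M a).range

/-- The shift by `r` which moves degree `0` to degree `r`. -/
abbrev degShift (r : ℤ) : CochainComplex (ModuleCat.{u} G.Alg) ℤ ⥤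
    CochainComplex (ModuleCat.{u} G.Alg) ℤ := shiftFunctor _ (-r)

/-- The base point element `b_0` of `P(C)`, as an element of degree `r` of the shifted complex. -/
def GWord.bShift (C : G.GWord) (r : ℤ) : ((degShift (G := G) r).obj C.complex).X r :=
  (CochainComplex.shiftFunctorObjXIso C.complex (-r) r 0 (by lia)).inv C.bBase

/-- The quotient functor from complexes to the homotopy category. -/
abbrev toK : CochainComplex (ModuleCat.{u} G.Alg) ℤ ⥤
    HomotopyCategory (ModuleCat.{u} G.Alg) (ComplexShape.up ℤ) :=
  HomotopyCategory.quotient _ _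

end GentleData

end

noncomputable section

namespace GentleData

/-! ### Generators of `Λ` -/

section Generators

variable {k V A : Type u} [Field k] [Fintype V] [Fintype A] (G : GentleData k V A)

/-! The map `a⟨C⟩` fixes `b_0`, so `(fa)(b_0) = f(b_0)`, and the first claim says that `m ∈ e_v M^r`
lies in `CM` exactly when `m = f(b_0)` for some morphism `f : P(C(↙↘))[r] ⟶ M`. Up to signs caused
by the shift, such an `f` is a family `s_i ∈ e_{v(i)} M`, indexed by the places of `C(↙↘)`, with
`d_M(s_i)` given by the formula for `b_i^- + b_i^+` (`IsDiffSeq`).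

From `f` to `CM`: each pair of homotopy letters imposes a condition on one component `d_{l(γ),M}`.
The formula for `d_M(s_i)` has at most two terms, and adjacency of letters makes them begin with
different arrows, so the component can be read off (`IsDiffSeq.rel`).

From `CM` to `f`: the definition of `CM` supplies elements along `C`. The letters added on either
side are arrows with the orientation in which the condition reads `d_α m = α m'`, and this is always
solvable because `im d_M ⊆ rad M` (`Letter.exists_rel_of_isInvArrow`). What remains is to see that
these conditions on single components determine all of `d_M(s_i)` (`totalD_eq_of_letters`). The
arrows with head `v(i)` are separated by their signs, each sign belonging to one side of the place
`i`. An inverse letter on that side prescribes the component. A direct letter `[γ]` forces it to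
vanish: `γ d_M(s_i) = d_M(γ s_i) = 0` by `d_M² = 0`, and `γ` is injective on `βM` for the arrow `β`
in question (`Letter.Rel.sum_eq`). If there is no letter on that side, then by maximality of the
extension there is no arrow of that sign.

Two facts on projective modules are needed: the sum of the subspaces `βM` is direct, and `γ` acts
injectively on `βM` if `f(γ)β ∉ 𝓙`. Both reduce to `Λ`, where they are read off from a faithful
representation on paths.

The statement on homotopy classes holds because the functor to the homotopy category is full. -/

theorem alg_induction {P : G.Alg → Prop} (hc : ∀ c : k, P (G.proj (algebraMap k _ c)))
    (he : ∀ v, P (G.e v)) (ha : ∀ a, P (G.ar a)) (hadd : ∀ x y, P x → P y → P (x + y))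
    (hmul : ∀ x y, P x → P y → P (x * y)) (x : G.Alg) : P x := by
  obtain ⟨y, rfl⟩ := RingCon.mk'_surjective (G.Q.ideal k).ringCon x
  obtain ⟨z, rfl⟩ := RingQuot.mkAlgHom_surjective k _ y
  change P (G.proj _)
  induction z using FreeAlgebra.induction with
  | grade0 c => rw [AlgHom.commutes]; exact hc c
  | grade1 s =>
    rcases s with v | a
    · exact he v
    · exact ha a
  | mul x y hx hy => rw [map_mul, map_mul]; exact hmul _ _ hx hy
  | add x y hx hy => rw [map_add, map_add]; exact hadd _ _ hx hy

theorem sum_e : ∑ v, G.e v = 1 := by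
  have h := RingQuot.mkAlgHom_rel k (QuiverRel.PathRel.unit (Q := G.Q) (k := k))
  rw [map_sum, map_one] at h
  have h2 := congrArg G.proj h
  rw [map_sum, map_one] at h2
  exact h2

theorem e_mul_e_of_ne {v w : V} (h : v ≠ w) : G.e v * G.e w = 0 := by
  have h1 := RingQuot.mkAlgHom_rel k (QuiverRel.PathRel.orth (Q := G.Q) (k := k) v w h)
  rw [map_mul, map_zero] at h1
  have h2 := congrArg G.proj h1
  rw [map_mul, map_zero] at h2
  exact h2

theorem ar_mul_e (a : A) : G.ar a * G.e (G.Q.tl a) = G.ar a := by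
  unfold e ar
  rw [← map_mul]
  congr 1
  unfold QuiverRel.triv QuiverRel.arrow
  rw [← map_mul]
  exact RingQuot.mkAlgHom_rel k (QuiverRel.PathRel.tail a)

theorem e_mul_ar_of_ne {v : V} {a : A} (h : v ≠ G.Q.hd a) : G.e v * G.ar a = 0 := by
  rw [← G.e_mul_ar a, ← mul_assoc, G.e_mul_e_of_ne h, zero_mul]

theorem proj_algebraMap_mul_comm (c : k) (x : G.Alg) :
    G.proj (algebraMap k _ c) * x = x * G.proj (algebraMap k _ c) := by
  obtain ⟨y, rfl⟩ := RingCon.mk'_surjective (G.Q.ideal k).ringCon x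
  change _ * G.proj y = G.proj y * _
  rw [← map_mul, ← map_mul, Algebra.commutes]

end Generators

/-! ### The representation of `Λ` on paths -/

theorem paths_hom_ext {k V A N : Type*} [Field k] [AddCommMonoid N] [Module k N]
    {f g : (V × List A →₀ k) →ₗ[k] N}
    (h : ∀ p, f (Finsupp.single p 1) = g (Finsupp.single p 1)) : f = g :=
  Finsupp.lhom_ext' fun p => LinearMap.ext_ring (h p)

section Paths

variable {k V A : Type u} [Field k] [Fintype V] [Fintype A] (G : GentleData k V A)

/-- The head of a path, given by its tail and its list of arrows. -/
def pathHd : V × List A → V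
  | (v, []) => v
  | (_, a :: _) => G.Q.hd a

/-- The arrow `a` may be composed with the given path, without giving an element of `𝓙`. -/
def CanCons (a : A) : V × List A → Prop
  | (v, []) => G.Q.tl a = v
  | (_, b :: _) => G.Q.tl a = G.Q.hd b ∧ G.Q.arrow k a * G.Q.arrow k b ∉ G.Q.ideal k

variable {G} in
theorem CanCons.tl_eq {a : A} {p : V × List A} (h : G.CanCons a p) : G.Q.tl a = G.pathHd p := by
  rcases p with ⟨v, _ | ⟨b, p⟩⟩
  · exact h
  · exact h.1

open Classical in
/-- Multiplication by `e_v` on paths. -/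
def trivAct (v : V) : Module.End k (V × List A →₀ k) :=
  Finsupp.linearCombination k fun p => if G.pathHd p = v then Finsupp.single p 1 else 0

open Classical in
/-- Multiplication by the arrow `a` on paths. -/
def arrowAct (a : A) : Module.End k (V × List A →₀ k) :=
  Finsupp.linearCombination k fun p => if G.CanCons a p then Finsupp.single (p.1, a :: p.2) 1 else 0

theorem trivAct_of {v : V} {p : V × List A} (h : G.pathHd p = v) :
    G.trivAct v (Finsupp.single p 1) = Finsupp.single p 1 := by simp [trivAct, h]

theorem trivAct_of_ne {v : V} {p : V × List A} (h : G.pathHd p ≠ v) :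
    G.trivAct v (Finsupp.single p 1) = 0 := by simp [trivAct, h]

theorem arrowAct_of {a : A} {p : V × List A} (h : G.CanCons a p) :
    G.arrowAct a (Finsupp.single p 1) = Finsupp.single (p.1, a :: p.2) 1 := by simp [arrowAct, h]

theorem arrowAct_of_not {a : A} {p : V × List A} (h : ¬ G.CanCons a p) :
    G.arrowAct a (Finsupp.single p 1) = 0 := by simp [arrowAct, h]

/-- The action of the path algebra on paths. -/
def freeRep : G.Q.PathAlgebra k →ₐ[k] Module.End k (V × List A →₀ k) :=
  RingQuot.liftAlgHom k ⟨FreeAlgebra.lift k (Sum.elim G.trivAct G.arrowAct), by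
    -- All pairs (vertex, list of arrows) are basis vectors, composable or not. The five relations
    -- inspect only the head of a pair, so the superfluous vectors do no harm.
    rintro _ _ (v | ⟨v, w, hvw⟩ | _ | a | a)
    · simp only [map_mul, FreeAlgebra.lift_ι_apply, Sum.elim_inl]
      refine paths_hom_ext fun p => ?_
      rw [Module.End.mul_apply]
      by_cases h : G.pathHd p = v
      · rw [G.trivAct_of h, G.trivAct_of h]
      · rw [G.trivAct_of_ne h, map_zero]
    · simp only [map_mul, FreeAlgebra.lift_ι_apply, Sum.elim_inl, map_zero]
      refine paths_hom_ext fun p => ?_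
      rw [Module.End.mul_apply, LinearMap.zero_apply]
      by_cases h : G.pathHd p = w
      · rw [G.trivAct_of h, G.trivAct_of_ne fun h' => hvw (h'.symm.trans h)]
      · rw [G.trivAct_of_ne h, map_zero]
    · simp only [map_sum, FreeAlgebra.lift_ι_apply, Sum.elim_inl, map_one]
      refine paths_hom_ext fun p => ?_
      rw [LinearMap.sum_apply, Finset.sum_eq_single (G.pathHd p), G.trivAct_of rfl,
        Module.End.one_apply]
      · exact fun w _ h => G.trivAct_of_ne h.symm
      · exact fun h => absurd (Finset.mem_univ _) h
    · simp only [map_mul, FreeAlgebra.lift_ι_apply, Sum.elim_inl, Sum.elim_inr]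
      refine paths_hom_ext fun p => ?_
      rw [Module.End.mul_apply]
      by_cases h : G.CanCons a p
      · rw [G.arrowAct_of h]
        exact G.trivAct_of (p := (p.1, a :: p.2)) rfl
      · rw [G.arrowAct_of_not h, map_zero]
    · simp only [map_mul, FreeAlgebra.lift_ι_apply, Sum.elim_inl, Sum.elim_inr]
      refine paths_hom_ext fun p => ?_
      rw [Module.End.mul_apply]
      by_cases h : G.pathHd p = G.Q.tl a
      · rw [G.trivAct_of h]
      · rw [G.trivAct_of_ne h, map_zero, G.arrowAct_of_not fun h' => h h'.tl_eq.symm]⟩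

theorem freeRep_triv (v : V) : G.freeRep (G.Q.triv k v) = G.trivAct v := by
  simp [freeRep, QuiverRel.triv]

theorem freeRep_arrow (a : A) : G.freeRep (G.Q.arrow k a) = G.arrowAct a := by
  simp [freeRep, QuiverRel.arrow]

/-- After `b` has acted, every surviving list starts with `b`, and `CanCons` then forbids prefixing
`a` when `ab ∈ 𝓙`. -/
theorem ideal_le_ker : G.Q.ideal k ≤ TwoSidedIdeal.ker G.freeRep := by
  intro z hz
  refine TwoSidedIdeal.mem_span_iff.1 hz _ ?_
  rintro _ ⟨⟨a, b⟩, hp, rfl⟩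
  rw [SetLike.mem_coe, TwoSidedIdeal.mem_ker, map_mul, freeRep_arrow, freeRep_arrow]
  refine paths_hom_ext fun p => ?_
  rw [Module.End.mul_apply, LinearMap.zero_apply]
  by_cases h : G.CanCons b p
  · rw [G.arrowAct_of h, G.arrowAct_of_not]
    exact fun h' => h'.2 (TwoSidedIdeal.subset_span ⟨(a, b), hp, rfl⟩)
  · rw [G.arrowAct_of_not h, map_zero]

/-- The action of `Λ` on the vector space with basis the paths not in `𝓙`. -/
def rep : G.Alg →+* Module.End k (V × List A →₀ k) :=
  (G.Q.ideal k).ringCon.lift (G.freeRep : G.Q.PathAlgebra k →+* _) fun _ _ h =>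
    (TwoSidedIdeal.ker_ringCon _).1 (TwoSidedIdeal.ringCon_le_iff.1 G.ideal_le_ker h)

theorem rep_proj (x : G.Q.PathAlgebra k) : G.rep (G.proj x) = G.freeRep x := rfl

theorem rep_e (v : V) : G.rep (G.e v) = G.trivAct v := G.freeRep_triv v

theorem rep_ar (a : A) : G.rep (G.ar a) = G.arrowAct a := G.freeRep_arrow a

/-- The sum of the trivial paths. -/
def pathOne : V × List A →₀ k := ∑ v : V, Finsupp.single (v, []) 1

/-- The element of `Λ` given by a linear combination of paths. -/
def evalPaths : (V × List A →₀ k) →+ G.Alg :=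
  Finsupp.liftAddHom fun p =>
    (AddMonoidHom.mulRight (G.word p.2 * G.e p.1)).comp
      (G.proj.comp (algebraMap k _)).toAddMonoidHom

theorem evalPaths_single (p : V × List A) (c : k) :
    G.evalPaths (Finsupp.single p c) = G.proj (algebraMap k _ c) * (G.word p.2 * G.e p.1) := by
  simp [evalPaths]

theorem e_mul_path (p : V × List A) :
    G.e (G.pathHd p) * (G.word p.2 * G.e p.1) = G.word p.2 * G.e p.1 := by
  rcases p with ⟨v, _ | ⟨a, p⟩⟩
  · simp [word, QuiverRel.pathProd, pathHd, triv_idem]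
  · simp only [pathHd]
    rw [word_cons, ← mul_assoc, ← mul_assoc, e_mul_ar]

/-- If `a` cannot be prefixed to a path, then either the vertices do not match or the product with
the leading arrow lies in `𝓙`; in both cases the product in `Λ` is zero as well. Hence evaluation is
`Λ`-linear, as is seen on generators. -/
theorem evalPaths_rep (x : G.Alg) :
    ∀ w, G.evalPaths (G.rep x w) = x * G.evalPaths w := by
  have key : ∀ f : Module.End k (V × List A →₀ k), ∀ y : G.Alg,
      (∀ p, G.evalPaths (f (Finsupp.single p 1)) = y * (G.word p.2 * G.e p.1)) →
      ∀ w, G.evalPaths (f w) = y * G.evalPaths w := by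
    intro f y h w
    induction w using Finsupp.induction_linear with
    | zero => simp
    | add w w' h1 h2 => rw [map_add, map_add, h1, h2, map_add, mul_add]
    | single p c =>
      have hs : ∀ w, G.evalPaths (c • w) = G.proj (algebraMap k _ c) * G.evalPaths w := by
        intro w
        induction w using Finsupp.induction_linear with
        | zero => simp
        | add w w' h1 h2 => rw [smul_add, map_add, h1, h2, map_add, mul_add]
        | single p c' =>
          rw [Finsupp.smul_single, evalPaths_single, evalPaths_single, smul_eq_mul, map_mul,
            map_mul, mul_assoc]
      have h1 : Finsupp.single p c = c • Finsupp.single p (1 : k) := by simp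
      rw [h1, map_smul, hs, hs, h, evalPaths_single, map_one, map_one, one_mul,
        ← mul_assoc, proj_algebraMap_mul_comm, mul_assoc]
  induction x using G.alg_induction with
  | hc c =>
    refine key _ _ fun p => ?_
    rw [rep_proj, AlgHom.commutes, Module.algebraMap_end_apply, Finsupp.smul_single,
      evalPaths_single, smul_eq_mul, mul_one]
  | he v =>
    refine key _ _ fun p => ?_
    rw [rep_e]
    by_cases h : G.pathHd p = v
    · subst h
      rw [G.trivAct_of rfl, evalPaths_single, map_one, map_one, one_mul, e_mul_path]
    · rw [G.trivAct_of_ne h, map_zero, ← G.e_mul_path, ← mul_assoc, G.e_mul_e_of_ne (Ne.symm h),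
        zero_mul]
  | ha a =>
    refine key _ _ fun p => ?_
    rw [rep_ar]
    by_cases h : G.CanCons a p
    · rw [G.arrowAct_of h, evalPaths_single, map_one, map_one, one_mul, word_cons, mul_assoc]
    · rw [G.arrowAct_of_not h, map_zero]
      by_cases ht : G.Q.tl a = G.pathHd p
      · rcases p with ⟨v, _ | ⟨b, p⟩⟩
        · exact absurd ht h
        · have hb : G.Q.arrow k a * G.Q.arrow k b ∈ G.Q.ideal k := by
            by_contra hb
            exact h ⟨ht, hb⟩
          rw [word_cons, ← mul_assoc, ← mul_assoc, ar_mul_ar G hb, zero_mul, zero_mul]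
      · rw [← G.ar_mul_e, ← G.e_mul_path, ← mul_assoc, mul_assoc (G.ar a), G.e_mul_e_of_ne ht,
          mul_zero, zero_mul]
  | hadd x y hx hy => intro w; rw [map_add, LinearMap.add_apply, map_add, hx, hy, add_mul]
  | hmul x y hx hy => intro w; rw [map_mul, Module.End.mul_apply, hx, hy, mul_assoc]

theorem evalPaths_pathOne : G.evalPaths pathOne = 1 := by
  rw [pathOne, map_sum, ← G.sum_e]
  refine Finset.sum_congr rfl fun v _ => ?_
  rw [evalPaths_single]
  simp [word, QuiverRel.pathProd]

/-- Evaluating `x · pathOne` returns `x`, so an element of `Λ` may be tested on the coefficients of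
its action on `pathOne`. -/
theorem eq_zero_of_rep {x : G.Alg} (h : G.rep x pathOne = 0) : x = 0 := by
  have h1 := G.evalPaths_rep x pathOne
  rw [h, map_zero, evalPaths_pathOne, mul_one] at h1
  exact h1.symm

theorem arrowAct_apply_ne {a : A} (w : V × List A →₀ k) {p : V × List A}
    (h : p.2.head? ≠ some a) : G.arrowAct a w p = 0 := by
  induction w using Finsupp.induction_linear with
  | zero => simp
  | add w w' h1 h2 => rw [map_add, Finsupp.add_apply, h1, h2, add_zero]
  | single q c =>
    have h1 : Finsupp.single q c = c • Finsupp.single q (1 : k) := by simp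
    rw [h1, map_smul, Finsupp.smul_apply]
    by_cases hq : G.CanCons a q
    · rw [G.arrowAct_of hq, Finsupp.single_eq_of_ne, smul_zero]
      rintro rfl
      exact h rfl
    · rw [G.arrowAct_of_not hq]; simp

open Classical in
theorem arrowAct_apply_cons {a : A} (w : V × List A →₀ k) (v : V) (p : List A) :
    G.arrowAct a w (v, a :: p) = if G.CanCons a (v, p) then w (v, p) else 0 := by
  induction w using Finsupp.induction_linear with
  | zero => simp
  | add w w' h1 h2 =>
    rw [map_add, Finsupp.add_apply, h1, h2, Finsupp.add_apply]
    split_ifs <;> simp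
  | single q c =>
    have h1 : Finsupp.single q c = c • Finsupp.single q (1 : k) := by simp
    rw [h1, map_smul, Finsupp.smul_apply, Finsupp.smul_apply]
    by_cases hqp : q = (v, p)
    · subst hqp
      by_cases hq : G.CanCons a (v, p)
      · rw [G.arrowAct_of hq, if_pos hq]; simp
      · rw [G.arrowAct_of_not hq, if_neg hq]; simp
    · rw [Finsupp.single_eq_of_ne (Ne.symm hqp), smul_zero, ite_self]
      by_cases hq : G.CanCons a q
      · rw [G.arrowAct_of hq, Finsupp.single_eq_of_ne, smul_zero]
        rintro h
        apply hqp
        rw [Prod.mk.injEq, List.cons.injEq] at h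
        exact Prod.ext h.1.symm h.2.2.symm
      · rw [G.arrowAct_of_not hq]; simp

/-- Only lists starting with `b` occur in the image of `b`, so different arrows contribute to
disjoint sets of coefficients: the right ideals `bΛ` form a direct sum. -/
theorem ar_mul_eq_zero_of_sum {s : Finset A} {c : A → G.Alg} (h : ∑ b ∈ s, G.ar b * c b = 0)
    {a : A} (ha : a ∈ s) : G.ar a * c a = 0 := by
  refine G.eq_zero_of_rep (Finsupp.ext fun p => ?_)
  have h1 : (G.rep (∑ b ∈ s, G.ar b * c b) pathOne) p = 0 := by rw [h, map_zero]; rfl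
  simp only [map_sum, map_mul, LinearMap.sum_apply, Module.End.mul_apply, rep_ar,
    Finsupp.finsetSum_apply] at h1
  rw [map_mul, Module.End.mul_apply, rep_ar, Finsupp.zero_apply]
  by_cases hp : p.2.head? = some a
  · rw [Finset.sum_eq_single a] at h1
    · exact h1
    · intro b _ hb
      refine G.arrowAct_apply_ne _ ?_
      rw [hp]
      exact fun h' => hb (Option.some.inj h').symm
    · exact fun h' => absurd ha h'
  · exact G.arrowAct_apply_ne _ hp

/-- Prefixing `a` to lists that start with `b` is allowed and injective, so no coefficient is lost.
-/
theorem ar_mul_cancel {a b : A} (ht : G.Q.tl a = G.Q.hd b)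
    (hab : G.Q.arrow k a * G.Q.arrow k b ∉ G.Q.ideal k) {x : G.Alg}
    (h : G.ar a * (G.ar b * x) = 0) : G.ar b * x = 0 := by
  refine G.eq_zero_of_rep (Finsupp.ext fun p => ?_)
  rw [map_mul, Module.End.mul_apply, rep_ar, Finsupp.zero_apply]
  rcases p with ⟨v, _ | ⟨c, p⟩⟩
  · exact G.arrowAct_apply_ne _ (by simp)
  by_cases hc : c = b
  · subst hc
    have h1 : (G.rep (G.ar a * (G.ar c * x)) pathOne) (v, a :: c :: p) = 0 := by
      rw [h, map_zero]; rfl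
    rw [map_mul, map_mul, Module.End.mul_apply, Module.End.mul_apply, rep_ar, rep_ar,
      arrowAct_apply_cons, if_pos ⟨ht, hab⟩] at h1
    exact h1
  · exact G.arrowAct_apply_ne _ (by simpa using hc)

/-- An arrow acts without vanishing on the trivial path at its tail, while `𝓙` acts by zero. -/
theorem arrow_not_mem (a : A) : G.Q.arrow k a ∉ G.Q.ideal k := by
  intro h
  have h1 : G.freeRep (G.Q.arrow k a) = 0 := (TwoSidedIdeal.mem_ker _).1 (G.ideal_le_ker h)
  rw [freeRep_arrow] at h1
  have h2 := LinearMap.congr_fun h1 (Finsupp.single (G.Q.tl a, []) 1)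
  rw [G.arrowAct_of (show G.CanCons a (G.Q.tl a, []) from rfl), LinearMap.zero_apply,
    Finsupp.single_eq_zero] at h2
  exact one_ne_zero h2

end Paths

/-! ### Arrows acting on projective modules -/

section Modules

variable {k V A : Type u} [Field k] [Fintype V] [Fintype A] {G : GentleData k V A}
variable {T : Type u} [AddCommGroup T] [Module G.Alg T]

/-- A projective module embeds in a free one, where identities can be checked coordinatewise in `Λ`.
-/
theorem exists_injective_finsupp (T : Type u) [AddCommGroup T] [Module G.Alg T]
    [h : Module.Projective G.Alg T] : ∃ f : T →ₗ[G.Alg] (T →₀ G.Alg), Function.Injective f := by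
  obtain ⟨f, hf⟩ := Module.projective_def'.1 h
  exact ⟨f, Function.LeftInverse.injective (g := Finsupp.linearCombination G.Alg id)
    (LinearMap.congr_fun hf)⟩

theorem ar_smul_eq_zero_of_sum [Module.Projective G.Alg T] {s : Finset A} {c : A → T}
    (h : ∑ b ∈ s, G.ar b • c b = 0) {a : A} (ha : a ∈ s) : G.ar a • c a = 0 := by
  obtain ⟨f, hinj⟩ := exists_injective_finsupp (G := G) T
  refine hinj (Finsupp.ext fun t => ?_)
  have h1 : f (∑ b ∈ s, G.ar b • c b) t = 0 := by rw [h, map_zero]; rfl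
  simp only [map_sum, map_smul, Finsupp.finsetSum_apply, Finsupp.smul_apply, smul_eq_mul] at h1
  rw [map_smul, map_zero, Finsupp.smul_apply, smul_eq_mul, Finsupp.zero_apply]
  exact G.ar_mul_eq_zero_of_sum (c := fun b => f (c b) t) h1 ha

theorem ar_smul_cancel [Module.Projective G.Alg T] {a b : A} (ht : G.Q.tl a = G.Q.hd b)
    (hab : G.Q.arrow k a * G.Q.arrow k b ∉ G.Q.ideal k) {x : T}
    (h : G.ar a • G.ar b • x = 0) : G.ar b • x = 0 := by
  obtain ⟨f, hinj⟩ := exists_injective_finsupp (G := G) T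
  refine hinj (Finsupp.ext fun t => ?_)
  have h1 : f (G.ar a • G.ar b • x) t = 0 := by rw [h, map_zero]; rfl
  rw [map_smul, map_smul] at h1
  rw [map_smul, map_zero]
  exact G.ar_mul_cancel ht hab h1

/-- Induction strips the leftmost arrow. Since `𝓙` is two-sided, a path outside `𝓙` has all its
consecutive products outside `𝓙`, so single arrows can be cancelled one at a time. -/
theorem word_smul_cancel [Module.Projective G.Alg T] :
    ∀ (p : List A) (hp : p ≠ []) (b : A), G.Q.IsPath p → G.Q.pathProd k p ∉ G.Q.ideal k →
      G.Q.tl (p.getLast hp) = G.Q.hd b →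
      G.Q.arrow k (p.getLast hp) * G.Q.arrow k b ∉ G.Q.ideal k →
      ∀ x : T, G.word p • G.ar b • x = 0 → G.ar b • x = 0
  | [], hp, _ => absurd rfl hp
  | [a], _, b => fun _ _ ht hab x h => by
    refine ar_smul_cancel ht hab ?_
    simpa [word, QuiverRel.pathProd, ar] using h
  | a :: a' :: p, _, b => fun hpath hn ht hab x h => by
    have h1 : G.Q.tl a = G.Q.hd a' := (List.isChain_cons_cons.1 hpath).1
    have h2 : G.Q.IsPath (a' :: p) := (List.isChain_cons_cons.1 hpath).2
    have h3 : G.Q.pathProd k (a' :: p) ∉ G.Q.ideal k := by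
      intro h3
      apply hn
      have : G.Q.pathProd k (a :: a' :: p) = G.Q.arrow k a * G.Q.pathProd k (a' :: p) := by
        simp [QuiverRel.pathProd]
      rw [this]
      exact TwoSidedIdeal.mul_mem_left _ _ _ h3
    have h4 : G.Q.arrow k a * G.Q.arrow k a' ∉ G.Q.ideal k := by
      intro h4
      apply hn
      have : G.Q.pathProd k (a :: a' :: p) =
          G.Q.arrow k a * G.Q.arrow k a' * G.Q.pathProd k p := by
        simp [QuiverRel.pathProd, mul_assoc]
      rw [this]
      exact TwoSidedIdeal.mul_mem_right _ _ _ h4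
    refine word_smul_cancel (a' :: p) (by simp) b h2 h3 (by simpa using ht) (by simpa using hab) x ?_
    rw [word_cons, mul_smul, word_cons, mul_smul] at h
    rw [word_cons, mul_smul]
    exact ar_smul_cancel h1 h4 h

theorem NzPath.val_smul_cancel [Module.Projective G.Alg T] (γ : G.NzPath) {b : A}
    (ht : γ.tl = G.Q.hd b) (hb : G.Q.arrow k γ.first * G.Q.arrow k b ∉ G.Q.ideal k) {x : T}
    (h : γ.val • G.ar b • x = 0) : G.ar b • x = 0 :=
  word_smul_cancel γ.arrows γ.ne_nil b γ.isPath γ.not_mem ht hb x h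

/-! ### The Jacobson radical and the arrow ideal -/

variable (G T) in
/-- The submodule `𝔯 T`, with `𝔯` the ideal of `Λ` generated by the arrows. -/
def arrowSpan : Submodule G.Alg T := Submodule.span G.Alg {x | ∃ a y, x = G.ar a • (y : T)}

theorem ar_smul_mem_arrowSpan (a : A) (y : T) : G.ar a • y ∈ arrowSpan G T :=
  Submodule.subset_span ⟨a, y, rfl⟩

theorem map_mem_arrowSpan {T' : Type u} [AddCommGroup T'] [Module G.Alg T'] (f : T →ₗ[G.Alg] T')
    {x : T} (hx : x ∈ arrowSpan G T) : f x ∈ arrowSpan G T' := by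
  have : arrowSpan G T ≤ (arrowSpan G T').comap f := by
    refine Submodule.span_le.2 ?_
    rintro _ ⟨a, y, rfl⟩
    rw [SetLike.mem_coe, Submodule.mem_comap, map_smul]
    exact ar_smul_mem_arrowSpan a _
  exact this hx

open Classical in
-- Sums `∑ b c_b` over all arrows form a set stable under `Λ`: scalars and idempotents act on the
-- coefficients, and an arrow turns any element into a single such term. Applying `e_v` then removes
-- the terms with head different from `v`.
theorem exists_sum_of_mem_arrowSpan {v : V} {x : T} (hx : x ∈ arrowSpan G T) (hv : G.e v • x = x) :
    ∃ c : A → T, x = ∑ b ∈ Finset.univ.filter (fun b => G.Q.hd b = v), G.ar b • c b := by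
  have hall : ∃ c : A → T, x = ∑ b, G.ar b • c b := by
    refine Submodule.span_induction (p := fun x _ => ∃ c : A → T, x = ∑ b, G.ar b • c b)
      ?_ ?_ ?_ ?_ hx
    · rintro _ ⟨a, y, rfl⟩
      refine ⟨Pi.single a y, ?_⟩
      rw [Finset.sum_eq_single a]
      · simp
      · intro b _ hb; simp [hb]
      · simp
    · exact ⟨0, by simp⟩
    · rintro _ _ _ _ ⟨c, rfl⟩ ⟨c', rfl⟩
      exact ⟨c + c', by simp [smul_add, Finset.sum_add_distrib]⟩
    · intro r x _ hx
      induction r using G.alg_induction generalizing x with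
      | hc r =>
        obtain ⟨c, rfl⟩ := hx
        refine ⟨fun b => G.proj (algebraMap k _ r) • c b, ?_⟩
        rw [Finset.smul_sum]
        refine Finset.sum_congr rfl fun b _ => ?_
        rw [smul_smul, proj_algebraMap_mul_comm, mul_smul]
      | he w =>
        obtain ⟨c, rfl⟩ := hx
        refine ⟨fun b => if G.Q.hd b = w then c b else 0, ?_⟩
        rw [Finset.smul_sum]
        refine Finset.sum_congr rfl fun b _ => ?_
        rw [smul_smul]
        dsimp only
        split_ifs with h
        · rw [← h, e_mul_ar]
        · rw [e_mul_ar_of_ne G (Ne.symm h), zero_smul, smul_zero]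
      | ha a =>
        refine ⟨Pi.single a x, ?_⟩
        rw [Finset.sum_eq_single a]
        · simp
        · intro b _ hb; simp [hb]
        · simp
      | hadd r r' h h' =>
        obtain ⟨c, hc⟩ := h x ‹_› hx
        obtain ⟨c', hc'⟩ := h' x ‹_› hx
        exact ⟨c + c', by simp [add_smul, hc, hc', Finset.sum_add_distrib]⟩
      | hmul r r' h h' =>
        rw [mul_smul]
        exact h _ (Submodule.smul_mem _ _ ‹_›) (h' x ‹_› hx)
  obtain ⟨c, hc⟩ := hall
  refine ⟨c, ?_⟩
  rw [← hv, hc, Finset.smul_sum, Finset.sum_filter]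
  refine Finset.sum_congr rfl fun b _ => ?_
  rw [smul_smul]
  split_ifs with h
  · rw [← h, e_mul_ar]
  · rw [e_mul_ar_of_ne G (Ne.symm h), zero_smul]

/-- If `x ∉ 𝔯T`, then some `e_v x ∉ 𝔯T`, and a maximal submodule avoiding `x` is found as the kernel
of a `k`-linear functional. No finiteness of `T` is needed. -/
theorem jacobson_le_arrowSpan : Module.jacobson G.Alg T ≤ arrowSpan G T := by
  intro x hx
  by_contra hxn
  have hv : ∃ v, G.e v • x ∉ arrowSpan G T := by
    by_contra! h
    apply hxn
    have : x = ∑ v, G.e v • x := by rw [← Finset.sum_smul, sum_e, one_smul]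
    rw [this]
    exact Submodule.sum_mem _ fun v _ => h v
  obtain ⟨v, hv⟩ := hv
  let φ : k →+* G.Alg := G.proj.comp (algebraMap k _)
  let _ : Module k T := Module.compHom T φ
  have hφ : ∀ (c : k) (t : T), c • t = φ c • t := fun _ _ => rfl
  -- This subspace contains `𝔯T` and `(1 - e_v)T`, and this makes the kernel of any functional that
  -- vanishes on it stable under the generators of `Λ`.
  let p : Submodule k T :=
    { carrier := {t | G.e v • t ∈ arrowSpan G T}
      zero_mem' := by simp
      add_mem' := fun {a b} ha hb => by
        simp only [Set.mem_ofPred_eq, smul_add] at *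
        exact Submodule.add_mem _ ha hb
      smul_mem' := fun c t ht => by
        simp only [Set.mem_ofPred_eq] at *
        rw [hφ, smul_smul]
        change (G.e v * G.proj (algebraMap k _ c)) • t ∈ _
        rw [← proj_algebraMap_mul_comm, mul_smul]
        exact Submodule.smul_mem _ _ ht }
  have hp : ∀ t, t ∈ p ↔ G.e v • t ∈ arrowSpan G T := fun _ => Iff.rfl
  obtain ⟨f, hfx, hfp⟩ := Submodule.exists_le_ker_of_notMem (p := p) (v := x) hv
  have hfp' : ∀ t, G.e v • t ∈ arrowSpan G T → f t = 0 := fun t ht => hfp ht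
  have hN : ∀ t ∈ arrowSpan G T, f t = 0 := fun t ht => hfp' t (Submodule.smul_mem _ _ ht)
  let K : Submodule G.Alg T :=
    { carrier := {t | f t = 0}
      zero_mem' := map_zero f
      add_mem' := fun {a b} ha hb => by
        simp only [Set.mem_ofPred_eq] at *
        rw [map_add, ha, hb, add_zero]
      smul_mem' := fun r t ht => by
        simp only [Set.mem_ofPred_eq] at *
        induction r using G.alg_induction generalizing t with
        | hc c =>
          change f (c • t) = 0
          rw [map_smul, ht, smul_zero]
        | he w =>
          by_cases hw : v = w
          · subst hw
            have h1 : f (G.e v • t - t) = 0 := hfp' _ (by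
              rw [smul_sub, smul_smul, triv_idem, sub_self]
              exact Submodule.zero_mem _)
            rw [map_sub, ht, sub_zero] at h1
            exact h1
          · refine hfp' _ ?_
            rw [smul_smul, G.e_mul_e_of_ne hw, zero_smul]
            exact Submodule.zero_mem _
        | ha a => exact hN _ (ar_smul_mem_arrowSpan a t)
        | hadd r r' h h' => rw [add_smul, map_add, h t ht, h' t ht, add_zero]
        | hmul r r' h h' => rw [mul_smul]; exact h _ (h' t ht) }
  have hK : ∀ t, t ∈ K ↔ f t = 0 := fun _ => Iff.rfl
  -- `K` has codimension one over `k`, so no `Λ`-submodule lies strictly between `K` and `T`.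
  have hcoatom : IsCoatom K := by
    refine ⟨fun h => hfx ?_, fun L hL => ?_⟩
    · exact (hK x).1 (h ▸ Submodule.mem_top)
    · obtain ⟨y, hyL, hyK⟩ := SetLike.exists_of_lt hL
      refine eq_top_iff.2 fun t _ => ?_
      have hy : f y ≠ 0 := hyK
      have h1 : t - (f t / f y) • y ∈ K := by
        rw [hK, map_sub, map_smul, smul_eq_mul, div_mul_cancel₀ _ hy, sub_self]
      have h2 : (f t / f y) • y ∈ L := L.smul_mem (φ (f t / f y)) hyL
      simpa using L.add_mem (hL.le h1) h2
  have : x ∈ K := (sInf_le (show K ∈ {m : Submodule G.Alg T | IsCoatom m} from hcoatom) :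
    Module.jacobson G.Alg T ≤ K) hx
  exact hfx this

end Modules

/-! ### Arrows at a place of a word -/

section Places

variable {k V A : Type u} [Field k] [Fintype V] [Fintype A] {G : GentleData k V A}

theorem Letter.flip_flip (x : G.Letter) : x.flip.flip = x := by cases x <;> rfl

variable (G) in
/-- An arrow, as an element of `𝐏`. -/
def arrowPath (a : A) : G.NzPath :=
  ⟨[a], by simp, List.isChain_singleton _, by
    simpa [QuiverRel.pathProd] using G.arrow_not_mem a⟩

namespace FinWord

variable {v : V} {δ : ℤˣ} (C : G.FinWord v δ)

/-- This and the next three lemmas express maximality of `C(↙↘)`: an extension stops only where no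
arrow letter fits. This is what excludes stray components of the differential at the ends of the
word. -/
theorem right_zero_none (h : C.right 0 = none) {y : G.Letter} (hy : y.IsInvArrow)
    (hv : y.hd = v) : y.sgn ≠ δ := by
  intro hs
  rcases C with ⟨_ | ⟨x, L⟩, hc, hst⟩
  · rw [right_of_ge _ (by simp)] at h
    have h1 : startRight ⟨[], hc, hst⟩ = some y :=
      (startRight_eq_some _).2 ⟨hy, by simpa [endVert] using hv.symm, by simp [endSgn, hs]⟩
    have h2 : startRight ⟨[], hc, hst⟩ = none := h
    rw [h1] at h2
    cases h2
  · rw [right_of_lt _ (by simp)] at h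
    cases h

theorem right_succ_none {n : ℕ} {x : G.Letter} (hx : C.right n = some x)
    (h : C.right (n + 1) = none) {y : G.Letter} (hy : y.IsInvArrow) : ¬ x.Adj y := by
  intro hxy
  rcases lt_trichotomy (n + 1) C.letters.length with hn | hn | hn
  · rw [C.right_of_lt hn] at h
    cases h
  · rw [C.right_of_lt (by lia)] at hx
    rw [C.right_of_ge hn.ge, hn, Nat.sub_self] at h
    have h2 : C.letters.getLast? = some x := by
      rw [List.getLast?_eq_getElem?, ← hn, Nat.add_sub_cancel,
        List.getElem?_eq_getElem (by lia)]
      exact hx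
    have h1 := (Letter.adj_iff _ _).1 hxy
    have h3 : C.startRight = some y := C.startRight_eq_some.2
      ⟨hy, by simpa [endVert, h2] using h1.1, by simp [endSgn, h2, h1.2]⟩
    have h4 : C.startRight = none := h
    rw [h3] at h4
    cases h4
  · rw [C.right_of_ge (by lia)] at hx
    rw [C.right_of_ge hn.le, Nat.sub_add_comm (by lia)] at h
    have h1 := iterOpt_succ_eq_some.2 ⟨x, hx, G.nextInv_eq_some.2 ⟨hy, hxy⟩⟩
    rw [h] at h1
    cases h1

theorem left_zero_none (h : left G v δ 0 = none) {y : G.Letter} (hy : y.IsDirArrow)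
    (hv : y.tl = v) : y.flip.sgn ≠ -δ := by
  intro hs
  have h1 : startLeft G v δ = some y := startLeft_eq_some.2 ⟨hy, hv, hs⟩
  have h2 : startLeft G v δ = none := h
  rw [h1] at h2
  cases h2

theorem left_succ_none {n : ℕ} {x : G.Letter} (hx : left G v δ n = some x)
    (h : left G v δ (n + 1) = none) {y : G.Letter} (hy : y.IsDirArrow) : ¬ y.Adj x := by
  intro hyx
  have h1 : left G v δ (n + 1) = some y :=
    iterOpt_succ_eq_some.2 ⟨x, hx, G.prevDir_eq_some.2 ⟨hy, hyx⟩⟩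
  rw [h] at h1
  cases h1

theorem ext_letter_le {i : ℤ} (h : i ≤ 0) : C.ext.letter i = left G v δ (-i).toNat :=
  C.extLetter_of_le h

theorem ext_letter_pos {i : ℤ} (h : 0 < i) : C.ext.letter i = C.right (i - 1).toNat :=
  C.extLetter_of_pos h

/-- The sign at a place of the word `C(↙↘)`: it is the sign of the letter to the right of the
place, and opposite to the sign of the inverse of the letter to the left. If one of these letters
does not exist, there is no arrow which could be used to extend the word. -/
theorem exists_sign {i : ℤ} (hi : i ∈ C.ext.index) : ∃ ε : ℤˣ,
    (∀ y, C.ext.letter (i + 1) = some y → y.sgn = ε) ∧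
    (∀ x, C.ext.letter i = some x → x.flip.sgn = -ε) ∧
    (C.ext.letter (i + 1) = none →
      ∀ y : G.Letter, y.IsInvArrow → y.hd = C.ext.vert i → y.sgn ≠ ε) ∧
    (C.ext.letter i = none →
      ∀ y : G.Letter, y.IsDirArrow → y.tl = C.ext.vert i → y.flip.sgn ≠ -ε) := by
  -- The sign is taken from the letter that certainly exists: the left one for `i > 0`, the right
  -- one for `i < 0`. At the place `0` both may be missing, and `δ` takes over.
  rcases lt_trichotomy 0 i with h | rfl | h
  · obtain ⟨x, hx⟩ := Option.isSome_iff_exists.1 (hi.1 h)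
    have hv := (C.ext.vert_of_letter hx).1
    refine ⟨-x.flip.sgn, fun y hy => ((Letter.adj_iff _ _).1 (C.ext.adj i x y hx hy)).2,
      fun x' hx' => ?_, fun hn y hy hyv hys => ?_, fun hn => ?_⟩
    · rw [hx] at hx'
      cases hx'
      rw [neg_neg]
    · rw [C.ext_letter_pos (by lia), show (i + 1 - 1).toNat = (i - 1).toNat + 1 by lia] at hn
      rw [C.ext_letter_pos h] at hx
      exact C.right_succ_none hx hn hy ((Letter.adj_iff _ _).2 ⟨by rw [hyv, hv], hys⟩)
    · rw [hx] at hn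
      cases hn
  · refine ⟨δ, fun y hy => (C.right_zero hy).2, fun x hx => (startLeft_eq_some.1 hx).2.2,
      fun hn y hy hyv => C.right_zero_none hn hy hyv, fun hn y hy hyv =>
      left_zero_none hn hy hyv⟩
  · obtain ⟨y, hy⟩ := Option.isSome_iff_exists.1 (hi.2 h)
    have hv := (C.ext.vert_of_letter hy).2.1
    rw [add_sub_cancel_right] at hv
    refine ⟨y.sgn, fun y' hy' => ?_, fun x hx => ?_, fun hn => ?_, fun hn x hx hxv hxs => ?_⟩
    · rw [hy] at hy'
      cases hy'
      rfl
    · rw [((Letter.adj_iff _ _).1 (C.ext.adj i x y hx hy)).2, neg_neg]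
    · rw [hy] at hn
      cases hn
    · rw [C.ext_letter_le h.le, show (-i).toNat = (-(i + 1)).toNat + 1 by lia] at hn
      rw [C.ext_letter_le (by lia)] at hy
      exact left_succ_none hy hn hx
        ((Letter.adj_iff _ _).2 ⟨by rw [hxv, hv], by rw [hxs, neg_neg]⟩)

end FinWord

end Places

/-! ### The differential of `⊕ Mⁱ` -/

section Differential

variable {k V A : Type u} [Field k] [Fintype V] [Fintype A] {G : GentleData k V A}
variable (M : CochainComplex (ModuleCat.{u} G.Alg) ℤ)

theorem totalD_lof (i : ℤ) (x : M.X i) :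
    totalD M (DirectSum.lof G.Alg ℤ (fun i => M.X i) i x) =
      DirectSum.lof G.Alg ℤ (fun i => M.X i) (i + 1) (M.d i (i + 1) x) := by
  simp [totalD]

theorem total_induction {P : Total M → Prop} (h0 : P 0)
    (hl : ∀ i x, P (DirectSum.lof G.Alg ℤ (fun i => M.X i) i x))
    (hadd : ∀ x y, P x → P y → P (x + y)) (x : Total M) : P x :=
  DirectSum.induction_on x h0 hl hadd

theorem totalD_totalD (x : Total M) : totalD M (totalD M x) = 0 := by
  induction x using total_induction with
  | h0 => simp
  | hl i x =>
    rw [totalD_lof, totalD_lof]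
    have : M.d (i + 1) (i + 1 + 1) (M.d i (i + 1) x) = 0 := by
      have h := M.d_comp_d i (i + 1) (i + 1 + 1)
      exact congrArg (fun f => f.hom x) h
    rw [this, map_zero]
  | hadd x y hx hy => rw [map_add, map_add, hx, hy, add_zero]

/-- The elements produced along a word need not be homogeneous; this identity allows them to be
projected to single degrees afterwards. -/
theorem component_totalD (i : ℤ) (x : Total M) :
    DirectSum.component G.Alg ℤ (fun i => M.X i) (i + 1) (totalD M x) =
      M.d i (i + 1) (DirectSum.component G.Alg ℤ (fun i => M.X i) i x) := by
  induction x using total_induction with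
  | h0 => simp
  | hl j x =>
    rw [totalD_lof]
    by_cases h : j = i
    · subst h
      rw [DirectSum.component.lof_self, DirectSum.component.lof_self]
    · rw [DirectSum.component.of, dif_neg (by lia), DirectSum.component.of, dif_neg h, map_zero]
  | hadd x y hx hy => simp only [map_add, hx, hy]

variable {M}

theorem IsMinimalProj.total (hM : IsMinimalProj M) : Module.Projective G.Alg (Total M) := by
  have := hM.projective
  infer_instance

/-- Homotopical minimality enters here: the differential takes values in the radical, hence in the
span of the images of arrows. -/
theorem IsMinimalProj.totalD_mem (hM : IsMinimalProj M) (x : Total M) :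
    totalD M x ∈ arrowSpan G (Total M) := by
  induction x using total_induction with
  | h0 => simp
  | hl i x =>
    rw [totalD_lof]
    exact map_mem_arrowSpan _ (jacobson_le_arrowSpan (hM.minimal i ⟨x, rfl⟩))
  | hadd x y hx hy => rw [map_add]; exact Submodule.add_mem _ hx hy

open Classical in
theorem IsMinimalProj.exists_sum (hM : IsMinimalProj M) {v : V} {m : Total M}
    (hm : m ∈ vertexPart M v) : ∃ c : A → Total M,
      totalD M m = ∑ b ∈ Finset.univ.filter (fun b => G.Q.hd b = v), G.ar b • c b :=
  exists_sum_of_mem_arrowSpan (hM.totalD_mem m) (by rw [← map_smul, show G.e v • m = m from hm])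

/-! ### Pairs of homotopy letters as relations, and the component of the differential they control
-/

variable (M) in
/-- The relation `m ∈ x {m'}` for a pair `x` of homotopy letters. -/
def Letter.Rel : G.Letter → Total M → Total M → Prop
  | .dir γ, m, m' => m ∈ vertexPart M γ.tl ∧ IsArrowD M γ.last m' (γ.val • m)
  | .inv γ, m, m' => IsArrowD M γ.last m (γ.val • m') ∧ m' ∈ vertexPart M γ.tl

variable (M) in
/-- The contribution of the letter `x` between places with elements `m` and `m'` to the differential
of `m`. -/
def Letter.plus : G.Letter → Total M → Total M
  | .dir _, _ => 0
  | .inv γ, m' => γ.val • m'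

namespace Letter

/-- Inverting a letter interchanges the two ends of its relation, so the left-hand side of a place
can be treated as a right-hand side. -/
theorem rel_flip {x : G.Letter} {m m' : Total M} : x.flip.Rel M m' m ↔ x.Rel M m m' := by
  cases x <;> exact and_comm

theorem Rel.mem_hd {x : G.Letter} {m m' : Total M} (h : x.Rel M m m') :
    m ∈ vertexPart M x.hd := by
  cases x
  · exact h.1
  · exact h.1.1

theorem Rel.mem_tl {x : G.Letter} {m m' : Total M} (h : x.Rel M m m') :
    m' ∈ vertexPart M x.tl := by
  cases x
  · exact h.2.1
  · exact h.2

theorem Rel.mem_act {x : G.Letter} {m m' : Total M} (h : x.Rel M m m') {U : Set (Total M)}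
    (hU : m' ∈ U) : m ∈ x.act M U := by
  cases x
  · exact ⟨h.1, m', hU, h.2⟩
  · exact ⟨h.1.1, _, ⟨m', hU, rfl⟩, h.1⟩

theorem act_subset (x : G.Letter) (U : Set (Total M)) : x.act M U ⊆ vertexPart M x.hd := by
  intro m hm
  cases x
  · exact hm.1
  · exact hm.1

theorem exists_rel_of_mem_act {x : G.Letter} {U : Set (Total M)} (hU : U ⊆ vertexPart M x.tl)
    {m : Total M} (hm : m ∈ x.act M U) : ∃ m' ∈ U, x.Rel M m m' := by
  cases x
  · obtain ⟨h1, m', h2, h3⟩ := hm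
    exact ⟨m', h2, h1, h3⟩
  · obtain ⟨h1, _, ⟨m', h2, rfl⟩, h3⟩ := hm
    exact ⟨m', h2, h3, hU h2⟩

open Classical in
-- At most one arrow has the given head and sign. For `[γ⁻¹]` it is `l(γ)`, and directness of the
-- sum makes its component independent of the chosen expression. For `[γ]` it is an arrow `b` with
-- `f(γ) b ∉ 𝓙`, and its component is cancelled after multiplication by `γ`.
theorem Rel.sum_eq (hM : IsMinimalProj M) {x : G.Letter} {m m' : Total M} (h : x.Rel M m m')
    {c : A → Total M}
    (hc : totalD M m = ∑ b ∈ Finset.univ.filter (fun b => G.Q.hd b = x.hd), G.ar b • c b) :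
    ∑ b ∈ Finset.univ.filter (fun b => G.Q.hd b = x.hd ∧ G.sign (Sum.inl b) = -x.sgn),
      G.ar b • c b = x.plus M m' := by
  have := hM.total
  rcases x with γ | γ
  · obtain ⟨h1, h2, c', hc', hy⟩ := h
    -- `γ m` is the `l(γ)`-component of `d m'`; since `d² m' = 0` and the sum over arrows is direct,
    -- `d` kills each component of `d m'` separately.
    have hd : γ.val • totalD M m = 0 := by
      rw [← map_smul, hy, map_smul]
      have hdd := totalD_totalD M m'
      rw [hc', map_sum] at hdd
      simp only [map_smul] at hdd
      exact ar_smul_eq_zero_of_sum hdd (by simp)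
    have hne : ∀ b, G.Q.hd b = γ.tl → G.sign (Sum.inl b) = -G.sign (Sum.inr γ.first) →
        G.Q.arrow k γ.first * G.Q.arrow k b ∉ G.Q.ideal k := by
      intro b hb hs hmem
      have := (sign_mixed (G := G) (a := γ.first) (b := b) hb.symm).2 hmem
      exact neg_units_iff.1 hs this.symm
    refine Finset.sum_eq_zero fun b hb => ?_
    obtain ⟨hb1, hb2⟩ := (Finset.mem_filter.1 hb).2
    refine γ.val_smul_cancel hb1.symm (hne b hb1 hb2) ?_
    -- Any other arrow `b'` with this head has the opposite sign, so `f(γ) b' ∈ 𝓙` and `γ b' = 0`;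
    -- only the term of `b` survives.
    rw [hc, Finset.smul_sum, Finset.sum_eq_single b] at hd
    · exact hd
    · intro b' hb' hbb
      have hb'1 : G.Q.hd b' = γ.tl := (Finset.mem_filter.1 hb').2
      have hmem : G.Q.arrow k γ.first * G.Q.arrow k b' ∈ G.Q.ideal k := by
        refine (sign_mixed (G := G) (a := γ.first) (b := b') hb'1.symm).1 ?_
        by_contra hs
        refine hbb (sign_hd_eq (G := G) (hb'1.trans hb1.symm) ?_)
        rw [hb2]
        exact neg_units_iff.2 (Ne.symm hs)
      have h0 : γ.val * G.ar b' = 0 := by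
        have := G.word_mul_eq_zero γ.ne_nil (γ := G.arrowPath b') hmem
        simpa [NzPath.val, arrowPath, word, QuiverRel.pathProd, ar] using this
      rw [smul_smul, h0, zero_smul]
    · exact fun h => absurd (by simpa using hb1) h
  · obtain ⟨⟨h1, c', hc', hy⟩, h2⟩ := h
    have hs : ∑ b ∈ Finset.univ.filter (fun b => G.Q.hd b = G.Q.hd γ.last),
        G.ar b • (c b - c' b) = 0 := by
      simp only [smul_sub, Finset.sum_sub_distrib]
      rw [← hc']
      exact sub_eq_zero.2 hc.symm
    have hlast := ar_smul_eq_zero_of_sum hs (a := γ.last) (by simp)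
    rw [smul_sub, sub_eq_zero] at hlast
    rw [Finset.sum_eq_single γ.last, hlast, ← hy]
    · rfl
    · intro b hb hbl
      obtain ⟨hb1, hb2⟩ := (Finset.mem_filter.1 hb).2
      refine absurd (sign_hd_eq (G := G) hb1 (hb2.trans ?_)) hbl
      exact neg_neg _
    · intro h
      refine absurd (Finset.mem_filter.2 ⟨Finset.mem_univ _, ?_, ?_⟩) h
      · rfl
      · exact (neg_neg _).symm

/-- The sum of the components of the differential for arrows with a given sign. -/
theorem sum_eq_of_option (hM : IsMinimalProj M) {o : Option G.Letter} {v : V} {ε : ℤˣ}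
    {m m' : Total M} (h : ∀ y, o = some y → y.hd = v ∧ y.sgn = ε ∧ y.Rel M m m')
    (hn : o = none → ∀ y : G.Letter, y.IsInvArrow → y.hd = v → y.sgn ≠ ε) {c : A → Total M}
    {s : Finset A} (hs : ∀ b, b ∈ s ↔ G.Q.hd b = v)
    (hc : totalD M m = ∑ b ∈ s, G.ar b • c b)
    {s' : Finset A} (hs' : ∀ b, b ∈ s' ↔ G.Q.hd b = v ∧ G.sign (Sum.inl b) = -ε) :
    ∑ b ∈ s', G.ar b • c b = o.elim 0 fun y => y.plus M m' := by
  classical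
  rcases o with _ | y
  · refine Finset.sum_eq_zero fun b hb => ?_
    obtain ⟨h1, h2⟩ := (hs' b).1 hb
    -- An arrow `b` of this sign would give a letter `[b⁻¹]` by which the word could be extended.
    refine absurd ?_ (hn rfl (Letter.inv (G.arrowPath b)) rfl h1)
    change -G.sign (Sum.inl b) = ε
    rw [h2, neg_neg]
  · obtain ⟨rfl, rfl, h1⟩ := h y rfl
    have e1 : s = Finset.univ.filter (fun b => G.Q.hd b = y.hd) := by ext b; simp [hs]
    have e2 : s' = Finset.univ.filter
        (fun b => G.Q.hd b = y.hd ∧ G.sign (Sum.inl b) = -y.sgn) := by ext b; simp [hs']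
    subst e1 e2
    exact h1.sum_eq hM hc

/-- By minimality `d m = ∑ β c_β`, and `m' = e_{t(α)} c_α` solves `d_α m = α m'`. Letters `[α⁻¹]`
therefore impose no condition on `m`, which is why the word may be prolonged by them. -/
theorem exists_rel_of_isInvArrow (hM : IsMinimalProj M) {y : G.Letter} (hy : y.IsInvArrow)
    {m : Total M} (hm : m ∈ vertexPart M y.hd) : ∃ m', y.Rel M m m' := by
  rcases y with γ | γ
  · exact hy.elim
  obtain ⟨c, hc⟩ := hM.exists_sum hm
  obtain ⟨⟨p, hne, hp, hn⟩, rfl⟩ : ∃ γ' : G.NzPath, γ' = γ := ⟨γ, rfl⟩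
  obtain ⟨a, rfl⟩ := List.length_eq_one_iff.1 hy
  refine ⟨G.e (G.Q.tl a) • c a, ⟨hm, c, hc, ?_⟩, ?_⟩
  · have : NzPath.val (G := G) ⟨[a], hne, hp, hn⟩ = G.ar a := by
      simp [NzPath.val, word, QuiverRel.pathProd, ar]
    rw [this, smul_smul, ar_mul_e]
    rfl
  · change G.e (G.Q.tl a) • G.e (G.Q.tl a) • c a = _
    rw [smul_smul, triv_idem]

end Letter

/-- The sum over arrows with head `v` splits by sign: sign `-ε` is governed by the letter on the
right, sign `ε` by the inverse of the letter on the left. -/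
theorem totalD_eq_of_letters (hM : IsMinimalProj M) {o o' : Option G.Letter} {v : V} {ε : ℤˣ}
    {m m₁ m₂ : Total M} (hm : m ∈ vertexPart M v)
    (h : ∀ y, o = some y → y.hd = v ∧ y.sgn = ε ∧ y.Rel M m m₁)
    (hn : o = none → ∀ y : G.Letter, y.IsInvArrow → y.hd = v → y.sgn ≠ ε)
    (h' : ∀ x, o' = some x → x.tl = v ∧ x.flip.sgn = -ε ∧ x.Rel M m₂ m)
    (hn' : o' = none → ∀ x : G.Letter, x.IsDirArrow → x.tl = v → x.flip.sgn ≠ -ε) :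
    totalD M m = (o'.elim 0 fun x => x.flip.plus M m₂) + o.elim 0 fun y => y.plus M m₁ := by
  classical
  obtain ⟨c, hc⟩ := hM.exists_sum hm
  have h1 := Letter.sum_eq_of_option hM (o := o) h hn (s := Finset.univ.filter (G.Q.hd · = v))
    (by simp) hc
    (s' := (Finset.univ.filter (G.Q.hd · = v)).filter (fun b => G.sign (Sum.inl b) = -ε)) (by simp)
  have h2 := Letter.sum_eq_of_option hM (o := o'.map Letter.flip) (v := v) (ε := -ε) (m' := m₂)
    (by
      rintro y hy
      obtain ⟨x, hx, rfl⟩ := Option.map_eq_some_iff.1 hy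
      obtain ⟨h1, h2, h3⟩ := h' x hx
      exact ⟨by rw [Letter.flip_hd, h1], h2, Letter.rel_flip.2 h3⟩)
    (by
      intro ho y hy hv
      have := hn' (Option.map_eq_none_iff.1 ho) y.flip (by
        rwa [← Letter.isInvArrow_flip, Letter.flip_flip]) (by
        rw [← Letter.flip_hd, Letter.flip_flip, hv])
      rwa [Letter.flip_flip] at this) (s := Finset.univ.filter (G.Q.hd · = v))
    (by simp) hc
    (s' := (Finset.univ.filter (G.Q.hd · = v)).filter (fun b => ¬ G.sign (Sum.inl b) = -ε)) (by
      intro b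
      simp only [Finset.mem_filter, Finset.mem_univ, true_and, neg_neg]
      refine and_congr_right fun _ => ?_
      rw [Letter.neg_units_iff, not_not])
  rw [hc, ← Finset.sum_filter_add_sum_filter_not _ (fun b => G.sign (Sum.inl b) = -ε), h1, h2,
    add_comm, Option.elim_map]
  rfl

end Differential

/-! ### Sequences of elements along a word -/

section Sequences

variable {k V A : Type u} [Field k] [Fintype V] [Fintype A] {G : GentleData k V A}
variable {M : CochainComplex (ModuleCat.{u} G.Alg) ℤ}

/-- The elements `s n` are compatible with the letters `R n`, which sit between the places `n` and
`n + 1`. -/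
def IsRelSeq (M : CochainComplex (ModuleCat.{u} G.Alg) ℤ) (R : ℕ → Option G.Letter)
    (s : ℕ → Total M) : Prop := ∀ n x, R n = some x → x.Rel M (s n) (s (n + 1))

/-- Each step is solvable without conditions, so a possibly infinite sequence is obtained by
repeated choice. -/
theorem exists_isRelSeq_of_isInvArrow (hM : IsMinimalProj M) {R : ℕ → Option G.Letter}
    (hR : ∀ n x, R n = some x → x.IsInvArrow) (hclosed : ∀ n, R n = none → R (n + 1) = none)
    (hadj : ∀ n x y, R n = some x → R (n + 1) = some y → x.tl = y.hd) {m : Total M}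
    (hm : ∀ x, R 0 = some x → m ∈ vertexPart M x.hd) : ∃ s, s 0 = m ∧ IsRelSeq M R s := by
  classical
  -- The value `0` is used only where no next element exists; it is never reached as long as letters
  -- continue.
  let f : ℕ → Total M → Total M := fun n m =>
    if h : ∃ m' x, R n = some x ∧ x.Rel M m m' then h.choose else 0
  have hf : ∀ n m x, R n = some x → m ∈ vertexPart M x.hd → x.Rel M m (f n m) := by
    intro n m x hx hm
    obtain ⟨m', hm'⟩ := Letter.exists_rel_of_isInvArrow hM (hR n x hx) hm
    have h : ∃ m' x, R n = some x ∧ x.Rel M m m' := ⟨m', x, hx, hm'⟩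
    obtain ⟨y, hy, hrel⟩ := h.choose_spec
    rw [hx] at hy
    cases hy
    simpa only [f, dif_pos h] using hrel
  let s : ℕ → Total M := fun n => Nat.rec m f n
  refine ⟨s, rfl, fun n => ?_⟩
  induction n with
  | zero => exact fun x hx => hf 0 m x hx (hm x hx)
  | succ n ih =>
    intro y hy
    rcases hx : R n with _ | x
    · rw [hclosed n hx] at hy
      cases hy
    · refine hf (n + 1) (s (n + 1)) y hy ?_
      rw [← hadj n x y hx hy]
      exact (ih x hx).mem_tl

theorem foldr_act_subset {u : V} : ∀ {L : List G.Letter},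
    L.foldr (fun x U => x.act M U) (vertexPart M u) ⊆ vertexPart M ((L.head?.map Letter.hd).getD u)
  | [] => subset_rfl
  | x :: _ => x.act_subset _

/-- The nested sets in the definition of `CM` are unwound letter by letter into witnesses; the last
of them lies in `e_u M`, and from there the sequence continues along `R`. -/
theorem exists_isRelSeq_append {R : ℕ → Option G.Letter} {u : V}
    (hR : ∀ m ∈ vertexPart M u, ∃ s, s 0 = m ∧ IsRelSeq M R s) :
    ∀ L : List G.Letter, L.IsChain Letter.Adj → (∀ x ∈ L.getLast?, x.tl = u) →
      ∀ m ∈ L.foldr (fun x U => x.act M U) (vertexPart M u), ∃ s, s 0 = m ∧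
        IsRelSeq M (fun n => if n < L.length then L[n]? else R (n - L.length)) s
  | [], _, _, m, hm => by simpa using hR m hm
  | x :: L, hL, hu, m, hm => by
    have hsub : L.foldr (fun x U => x.act M U) (vertexPart M u) ⊆ vertexPart M x.tl := by
      refine foldr_act_subset.trans (le_of_eq ?_)
      rcases L with _ | ⟨y, L⟩
      · rw [hu x (by simp)]; rfl
      · rw [(List.isChain_cons_cons.1 hL).1.tl_eq]; rfl
    obtain ⟨m', hm', hrel⟩ := Letter.exists_rel_of_mem_act hsub hm
    have hu' : ∀ z ∈ L.getLast?, z.tl = u := by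
      intro z hz
      refine hu z ?_
      rcases L with _ | ⟨y, L⟩
      · cases hz
      · simpa using hz
    obtain ⟨s, hs, hsR⟩ := exists_isRelSeq_append hR L hL.tail hu' m' hm'
    refine ⟨fun n => Nat.casesOn n m s, rfl, fun n y hy => ?_⟩
    rcases n with _ | n
    · simp only [List.length_cons, Nat.zero_lt_succ, if_true, List.getElem?_cons_zero,
        Option.some.injEq] at hy
      subst hy
      change x.Rel M m (s 0)
      rwa [hs]
    · refine hsR n y ?_
      simpa using hy

namespace FinWord

variable {v : V} {δ : ℤˣ} (C : G.FinWord v δ)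

theorem act_subset : C.act M ⊆ vertexPart M v := by
  refine foldr_act_subset.trans (le_of_eq ?_)
  rcases C with ⟨_ | ⟨x, L⟩, hc, hs⟩
  · rfl
  · exact congrArg _ (hs x rfl).1

/-- Membership in `CM` provides the elements along `C`, minimality those along the appended inverse
arrows. -/
theorem exists_isRelSeq_right (hM : IsMinimalProj M) {m : Total M} (hm : m ∈ C.act M) :
    ∃ s, s 0 = m ∧ IsRelSeq M C.right s := by
  refine exists_isRelSeq_append (R := iterOpt G.nextInv C.startRight) (u := C.endVert)
    (fun m hm => ?_) C.letters C.chain (fun x hx => ?_) m hm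
  · refine exists_isRelSeq_of_isInvArrow hM (fun n x hx => ?_)
      (fun n hn => iterOpt_succ_none hn)
      (fun n x y hx hy => ?_) (fun x hx => ?_)
    · rcases n with _ | n
      · exact (C.startRight_eq_some.1 hx).1
      · obtain ⟨z, -, hz⟩ := iterOpt_succ_eq_some.1 hx
        exact (G.nextInv_eq_some.1 hz).1
    · obtain ⟨z, hz, hzy⟩ := iterOpt_succ_eq_some.1 hy
      rw [hx] at hz
      cases hz
      exact (G.nextInv_eq_some.1 hzy).2.tl_eq
    · rwa [← (C.startRight_eq_some.1 hx).2.1]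
  · rw [Option.mem_def] at hx
    simp [endVert, hx]

variable (δ) in
-- Read from right to left, the prepended letters `[α]` become `[α⁻¹]`, so they are again
-- unobstructed.
theorem exists_isRelSeq_left (hM : IsMinimalProj M) {m : Total M} (hm : m ∈ vertexPart M v) :
    ∃ s, s 0 = m ∧ IsRelSeq M (fun n => (left G v δ n).map Letter.flip) s := by
  refine exists_isRelSeq_of_isInvArrow hM (fun n x hx => ?_) (fun n hn => ?_)
      (fun n x y hx hy => ?_) (fun x hx => ?_)
  · obtain ⟨y, hy, rfl⟩ := Option.map_eq_some_iff.1 hx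
    rw [Letter.isInvArrow_flip]
    rcases n with _ | n
    · exact (startLeft_eq_some.1 hy).1
    · obtain ⟨z, -, hz⟩ := iterOpt_succ_eq_some.1 hy
      exact (G.prevDir_eq_some.1 hz).1
  · rw [Option.map_eq_none_iff] at hn ⊢
    exact iterOpt_succ_none hn
  · obtain ⟨x, hx', rfl⟩ := Option.map_eq_some_iff.1 hx
    obtain ⟨y, hy', rfl⟩ := Option.map_eq_some_iff.1 hy
    obtain ⟨z, hz, hzy⟩ := iterOpt_succ_eq_some.1 hy'
    have h1 : some x = some z := hx'.symm.trans hz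
    cases h1
    rw [← Letter.flip_hd, Letter.flip_flip, Letter.flip_hd]
    exact (G.prevDir_eq_some.1 hzy).2.tl_eq.symm
  · obtain ⟨y, hy, rfl⟩ := Option.map_eq_some_iff.1 hx
    rwa [Letter.flip_hd, (startLeft_eq_some.1 hy).2.1]

/-- An element of `C M` is the start of a sequence of elements along `C(↙↘)` on which the
differential acts as on the basis elements of `P(C(↙↘))`. -/
theorem exists_sequence (hM : IsMinimalProj M) {m : Total M} (hm : m ∈ C.act M) :
    ∃ s : ℤ → Total M, s 0 = m ∧ (∀ i ∈ C.ext.index, s i ∈ vertexPart M (C.ext.vert i)) ∧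
      ∀ i ∈ C.ext.index, totalD M (s i) =
        ((C.ext.letter i).elim 0 fun x => x.flip.plus M (s (i - 1))) +
        (C.ext.letter (i + 1)).elim 0 fun y => y.plus M (s (i + 1)) := by
  have hmv := C.act_subset hm
  obtain ⟨s₁, h₁, hR⟩ := C.exists_isRelSeq_right hM hm
  obtain ⟨s₂, h₂, hL⟩ := exists_isRelSeq_left δ hM hmv
  -- The two half-sequences agree at the place `0`, where both equal `m`.
  let s : ℤ → Total M := fun i => if 0 ≤ i then s₁ i.toNat else s₂ (-i).toNat
  have hs₁ : ∀ i, 0 ≤ i → s i = s₁ i.toNat := fun i hi => if_pos hi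
  have hs₂ : ∀ i, i ≤ 0 → s i = s₂ (-i).toNat := by
    intro i hi
    rcases hi.lt_or_eq with h | rfl
    · exact if_neg (by lia)
    · rw [hs₁ 0 le_rfl]
      exact h₁.trans h₂.symm
  have hrel : ∀ i x, C.ext.letter i = some x → x.Rel M (s (i - 1)) (s i) := by
    intro i x hx
    rcases lt_or_ge 0 i with hi | hi
    · rw [C.ext_letter_pos hi] at hx
      have := hR _ x hx
      rwa [show (i - 1).toNat + 1 = i.toNat by lia, ← hs₁ _ (by lia), ← hs₁ _ (by lia)] at this
    · rw [C.ext_letter_le hi] at hx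
      have := hL (-i).toNat x.flip (by simp only [hx, Option.map_some])
      rwa [show (-i).toNat + 1 = (-(i - 1)).toNat by lia, ← hs₂ _ (by lia), ← hs₂ _ (by lia),
        Letter.rel_flip] at this
  have hs0 : s 0 = m := (hs₁ 0 le_rfl).trans h₁
  have hvert : ∀ i ∈ C.ext.index, s i ∈ vertexPart M (C.ext.vert i) := by
    intro i hi
    rcases lt_trichotomy 0 i with h | rfl | h
    · obtain ⟨x, hx⟩ := Option.isSome_iff_exists.1 (hi.1 h)
      rw [(C.ext.vert_of_letter hx).1]
      exact (hrel i x hx).mem_tl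
    · rw [hs0]
      exact hmv
    · obtain ⟨y, hy⟩ := Option.isSome_iff_exists.1 (hi.2 h)
      have hv := (C.ext.vert_of_letter hy).2.1
      have := (hrel _ y hy).mem_hd
      rw [add_sub_cancel_right] at hv this
      rwa [hv]
  refine ⟨s, hs0, hvert, fun i hi => ?_⟩
  obtain ⟨ε, hy, hx, hny, hnx⟩ := C.exists_sign hi
  refine totalD_eq_of_letters hM (hvert i hi) (fun y h => ⟨?_, hy y h, ?_⟩) hny
    (fun x h => ⟨(C.ext.vert_of_letter h).1.symm, hx x h, hrel i x h⟩) hnx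
  · have := (C.ext.vert_of_letter h).2.1
    rw [add_sub_cancel_right] at this
    exact this.symm
  · have := hrel _ y h
    rwa [add_sub_cancel_right] at this

end FinWord

end Sequences

/-! ### Morphisms from `P(C)` to `M` -/

section Morphisms

variable {k V A : Type u} [Field k] [Fintype V] [Fintype A] {G : GentleData k V A}
variable {M : CochainComplex (ModuleCat.{u} G.Alg) ℤ}

namespace GWord

variable (C : G.GWord)

/-- An element of `P(C)` of degree `n - r`, as an element of degree `n` of the shifted complex. -/
def shiftElem (r : ℤ) {n : ℤ} (x : C.piece (n + -r)) : ((degShift (G := G) r).obj C.complex).X n :=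
  x

theorem shift_d_shiftElem (r : ℤ) {n : ℤ} (x : C.piece (n + -r)) :
    ((degShift (G := G) r).obj C.complex).d n (n + 1) (C.shiftElem r x) =
      r.negOnePow • C.shiftElem r ⟨C.diff x.1, C.diff_mem (by lia) x.1 x.2⟩ := by
  have h : n + -r + 1 = n + 1 + -r := by lia
  rw [CochainComplex.shiftFunctor_obj_d', Int.negOnePow_neg]
  simp only [complex, dif_pos h]
  rfl

/-- The identification of degree `r - r` with degree `0` leaves the underlying function unchanged.
-/
theorem bShift_eq (r : ℤ) : C.bShift r =
    C.shiftElem r ⟨C.b 0, C.b_mem C.zero_mem_index (by rw [mu_zero]; lia)⟩ := by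
  have key : ∀ (n m : ℤ) (h : n = m) (x : C.piece n) (y : C.piece m), x.1 = y.1 →
      (HomologicalComplex.XIsoOfEq C.complex h).hom (x : C.complex.X n) = (y : C.complex.X m) := by
    rintro n _ rfl x y h
    rw [HomologicalComplex.XIsoOfEq_rfl]
    exact Subtype.ext h
  have h0 : (0 : ℤ) = r + -r := by lia
  exact key 0 (r + -r) h0 _ ⟨C.b 0, C.b_mem C.zero_mem_index (by rw [mu_zero]; lia)⟩ rfl

theorem exists_hom_of_linearMap (r : ℤ) (L : ∀ n, C.piece (n + -r) →ₗ[G.Alg] M.X n)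
    (hL : ∀ n (x : C.piece (n + -r)), M.d n (n + 1) (L n x) =
      ((r.negOnePow : ℤˣ) : ℤ) • L (n + 1) ⟨C.diff x.1, C.diff_mem (by lia) x.1 x.2⟩) :
    ∃ f : (degShift (G := G) r).obj C.complex ⟶ M, ∀ n (x : C.piece (n + -r)),
      f.f n (C.shiftElem r x) = L n x := by
  refine ⟨{ f n := ModuleCat.ofHom (X := C.piece (n + -r)) (L n), comm' := ?_ }, fun n x => rfl⟩
  rintro n _ rfl
  refine ModuleCat.hom_ext (LinearMap.ext fun x => ?_)
  have h1 := congrArg (ModuleCat.ofHom (X := C.piece (n + 1 + -r)) (L (n + 1))).hom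
    (C.shift_d_shiftElem r (n := n) x)
  refine (hL n x).trans (Eq.trans ?_ h1.symm)
  rw [Units.smul_def]
  exact (map_zsmul (L (n + 1)) _ _).symm

/-- `F` need not respect degrees: composing it with the projection to `M^n` on each piece still
gives a morphism, because `d_M` is homogeneous of degree one. -/
theorem exists_hom (r : ℤ) (F : (ℤ →₀ G.Alg) →ₗ[G.Alg] Total M)
    (hF : ∀ i ∈ C.index,
      totalD M (F (C.b i)) = ((r.negOnePow : ℤˣ) : ℤ) • F (C.diff (C.b i))) :
    ∃ f : (degShift (G := G) r).obj C.complex ⟶ M, ∀ n (x : C.piece (n + -r)),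
      f.f n (C.shiftElem r x) = DirectSum.component G.Alg ℤ (fun i => M.X i) n (F x.1) := by
  have hF' : ∀ {n : ℤ}, ∀ x ∈ C.piece n,
      totalD M (F x) = ((r.negOnePow : ℤˣ) : ℤ) • F (C.diff x) := by
    intro n x hx
    have : C.piece n ≤ LinearMap.eqLocus (totalD M ∘ₗ F)
        (((r.negOnePow : ℤˣ) : ℤ) • (F ∘ₗ C.diff)) := by
      refine Submodule.span_le.2 ?_
      rintro _ ⟨i, hi, -, rfl⟩
      exact hF i hi
    exact this hx
  refine C.exists_hom_of_linearMap r (fun n =>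
    DirectSum.component G.Alg ℤ (fun i => M.X i) n ∘ₗ F ∘ₗ (C.piece (n + -r)).subtype)
    fun n x => ?_
  simp only [LinearMap.comp_apply, Submodule.subtype_apply]
  rw [← component_totalD, hF' x.1 x.2, map_zsmul]

variable {C}

/-- The sequence `s` behaves under the differential as the basis elements of `P(C)`. -/
def IsDiffSeq (M : CochainComplex (ModuleCat.{u} G.Alg) ℤ) (C : G.GWord) (s : ℤ → Total M) :
    Prop :=
  (∀ i ∈ C.index, s i ∈ vertexPart M (C.vert i)) ∧
    ∀ i ∈ C.index, totalD M (s i) =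
      ((C.letter i).elim 0 fun x => x.flip.plus M (s (i - 1))) +
      (C.letter (i + 1)).elim 0 fun y => y.plus M (s (i + 1))

theorem map_bPlus (F : (ℤ →₀ G.Alg) →ₗ[G.Alg] Total M) (i : ℤ) :
    F (C.bPlus i) = (C.letter (i + 1)).elim 0 fun y => y.plus M (F (C.b (i + 1))) := by
  rcases h : C.letter (i + 1) with _ | γ | γ
  · rw [C.bPlus_of_not (by simp [h]), map_zero]; rfl
  · rw [C.bPlus_of_not (by simp [h]), map_zero]; rfl
  · rw [C.bPlus_of h, map_smul]; rfl

theorem map_bMinus (F : (ℤ →₀ G.Alg) →ₗ[G.Alg] Total M) (i : ℤ) :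
    F (C.bMinus i) = (C.letter i).elim 0 fun x => x.flip.plus M (F (C.b (i - 1))) := by
  rcases h : C.letter i with _ | γ | γ
  · rw [C.bMinus_of_not (by simp [h]), map_zero]; rfl
  · rw [C.bMinus_of h, map_smul]; rfl
  · rw [C.bMinus_of_not (by simp [h]), map_zero]; rfl

theorem plus_zsmul (y : G.Letter) (c : ℤ) (m : Total M) :
    y.plus M (c • m) = c • y.plus M m := by
  cases y
  · exact (smul_zero c).symm
  · exact smul_comm _ _ _

/-- The sign which relates the differentials of a complex and of its shift. -/
def twist (C : G.GWord) (r i : ℤ) : ℤ := ((r * C.mu i).negOnePow : ℤˣ)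

theorem twist_zero (r : ℤ) : C.twist r 0 = 1 := by simp [twist, mu_zero]

theorem twist_of_mu {r i j : ℤ} (h : C.mu j = C.mu i + 1) :
    C.twist r j = ((r.negOnePow : ℤˣ) : ℤ) * C.twist r i := by
  rw [twist, twist, h, mul_add, mul_one, Int.negOnePow_add, Units.val_mul, mul_comm]

theorem plus_twist_right (r : ℤ) {i : ℤ} {y : G.Letter} (h : C.letter (i + 1) = some y)
    (m : Total M) : y.plus M (C.twist r (i + 1) • m) =
      (((r.negOnePow : ℤˣ) : ℤ) * C.twist r i) • y.plus M m := by
  rw [plus_zsmul]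
  rcases y with γ | γ
  · exact (smul_zero _).trans (smul_zero _).symm
  · rw [C.twist_of_mu (i := i)]
    rw [mu_add_one, letterDeg, h]
    rfl

theorem plus_twist_left (r : ℤ) {i : ℤ} {x : G.Letter} (h : C.letter i = some x)
    (m : Total M) : x.flip.plus M (C.twist r (i - 1) • m) =
      (((r.negOnePow : ℤˣ) : ℤ) * C.twist r i) • x.flip.plus M m := by
  rw [plus_zsmul]
  rcases x with γ | γ
  · rw [C.twist_of_mu (i := i)]
    have h1 := C.mu_add_one (i - 1)
    rw [sub_add_cancel, letterDeg, h] at h1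
    have h2 : C.mu i = C.mu (i - 1) + -1 := h1
    lia
  · exact (smul_zero _).trans (smul_zero _).symm

/-- A neighbour that contributes to the differential at `i` always has degree `μ(i) + 1`: on the
right only inverse letters count, on the left only direct ones. Both terms thus acquire the same
factor `(-1)^r` relative to the twist at `i`. -/
theorem elim_plus_twist (r i : ℤ) (f g : ℤ → Total M)
    (hfg : ∀ j ∈ C.index, f j = C.twist r j • g j) :
    ((C.letter i).elim 0 fun x => x.flip.plus M (f (i - 1))) +
      ((C.letter (i + 1)).elim 0 fun y => y.plus M (f (i + 1))) =
      (((r.negOnePow : ℤˣ) : ℤ) * C.twist r i) •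
      (((C.letter i).elim 0 fun x => x.flip.plus M (g (i - 1))) +
        (C.letter (i + 1)).elim 0 fun y => y.plus M (g (i + 1))) := by
  rw [smul_add]
  congr 1
  · rcases h : C.letter i with _ | x
    · exact (smul_zero _).symm
    · simp only [Option.elim_some]
      rw [hfg _ (C.vert_of_letter h).2.2.2, C.plus_twist_left r h]
  · rcases h : C.letter (i + 1) with _ | y
    · exact (smul_zero _).symm
    · simp only [Option.elim_some]
      rw [hfg _ (C.vert_of_letter h).2.2.1, C.plus_twist_right r h]

theorem negOnePow_mul_self (r : ℤ) : ((r.negOnePow : ℤˣ) : ℤ) * ((r.negOnePow : ℤˣ) : ℤ) = 1 := by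
  rw [← Units.val_mul, ← Int.negOnePow_add, Int.negOnePow_even _ ⟨r, rfl⟩, Units.val_one]

/-- The morphism is `b_i ↦ (-1)^{r μ(i)} s_i`, followed by projection to the right degree. The twist
cancels the sign `(-1)^r` in the differential of the shifted complex and is trivial at the place
`0`. -/
theorem IsDiffSeq.exists_hom {s : ℤ → Total M} (hs : IsDiffSeq M C s) (r : ℤ) :
    ∃ f : (degShift (G := G) r).obj C.complex ⟶ M,
      f.f r (C.bShift r) = DirectSum.component G.Alg ℤ (fun i => M.X i) r (s 0) := by
  set F := Finsupp.linearCombination G.Alg fun i => C.twist r i • s i with hF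
  have hFb : ∀ i ∈ C.index, F (C.b i) = C.twist r i • s i := by
    intro i hi
    rw [hF, b, Finsupp.linearCombination_single, smul_comm]
    exact congrArg _ (hs.1 i hi)
  obtain ⟨f, hf⟩ := C.exists_hom (M := M) r F fun i hi => by
    rw [hFb i hi, diff_b, map_add, map_bPlus, map_bMinus,
      C.elim_plus_twist r i (fun j => F (C.b j)) s hFb, ← hs.2 i hi, map_zsmul,
      smul_smul, ← mul_assoc, negOnePow_mul_self, one_mul]
  refine ⟨f, ?_⟩
  rw [bShift_eq, hf, hFb 0 C.zero_mem_index, twist_zero, one_smul]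

/-! ### The sequence of elements given by a morphism -/

open Classical in
/-- The value of a morphism `P(C)[r] ⟶ M` on an element of degree `n - r` of `P(C)`. -/
def homVal {r : ℤ} (f : (degShift (G := G) r).obj C.complex ⟶ M) (n : ℤ) (x : ℤ →₀ G.Alg) :
    Total M :=
  -- The default `0` avoids carrying membership proofs; every use concerns elements of the right
  -- degree.
  if h : x ∈ C.piece (n + -r) then
    DirectSum.lof G.Alg ℤ (fun i => M.X i) n (f.f n (C.shiftElem r ⟨x, h⟩)) else 0

section HomVal

variable {r : ℤ} (f : (degShift (G := G) r).obj C.complex ⟶ M)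

theorem homVal_of_mem {n : ℤ} {x : ℤ →₀ G.Alg} (h : x ∈ C.piece (n + -r)) : homVal f n x =
    DirectSum.lof G.Alg ℤ (fun i => M.X i) n (f.f n (C.shiftElem r ⟨x, h⟩)) := dif_pos h

theorem homVal_zero (n : ℤ) : homVal f n 0 = 0 := by
  rw [homVal_of_mem f (Submodule.zero_mem _)]
  have h : C.shiftElem r ⟨0, (C.piece (n + -r)).zero_mem⟩ = 0 := rfl
  rw [h, map_zero, map_zero]

theorem homVal_add {n : ℤ} {x y : ℤ →₀ G.Alg} (hx : x ∈ C.piece (n + -r))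
    (hy : y ∈ C.piece (n + -r)) : homVal f n (x + y) = homVal f n x + homVal f n y := by
  rw [homVal_of_mem f hx, homVal_of_mem f hy, homVal_of_mem f (Submodule.add_mem _ hx hy)]
  have h : C.shiftElem r ⟨x + y, Submodule.add_mem _ hx hy⟩ =
    C.shiftElem r ⟨x, hx⟩ + C.shiftElem r ⟨y, hy⟩ := rfl
  rw [h, map_add, map_add]

theorem homVal_smul {n : ℤ} (a : G.Alg) {x : ℤ →₀ G.Alg} (hx : x ∈ C.piece (n + -r)) :
    homVal f n (a • x) = a • homVal f n x := by
  rw [homVal_of_mem f hx, homVal_of_mem f (Submodule.smul_mem _ a hx)]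
  have h : C.shiftElem r ⟨a • x, Submodule.smul_mem _ a hx⟩ = a • C.shiftElem r ⟨x, hx⟩ := rfl
  rw [h, map_smul, map_smul]

theorem totalD_homVal {n : ℤ} {x : ℤ →₀ G.Alg} (hx : x ∈ C.piece (n + -r)) :
    totalD M (homVal f n x) = ((r.negOnePow : ℤˣ) : ℤ) • homVal f (n + 1) (C.diff x) := by
  rw [homVal_of_mem f hx, homVal_of_mem f (C.diff_mem (by lia) x hx), totalD_lof]
  have h1 : M.d n (n + 1) (f.f n (C.shiftElem r ⟨x, hx⟩)) =
      f.f (n + 1) (((degShift (G := G) r).obj C.complex).d n (n + 1) (C.shiftElem r ⟨x, hx⟩)) :=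
    congrArg (fun g => g.hom (C.shiftElem r ⟨x, hx⟩)) (f.comm n (n + 1))
  rw [h1, shift_d_shiftElem, Units.smul_def, map_zsmul, map_zsmul]

theorem homVal_bPlus (n i : ℤ) (hi : C.mu i + 1 = n + -r) :
    homVal f n (C.bPlus i) = (C.letter (i + 1)).elim 0 fun y =>
      y.plus M (homVal f (C.mu (i + 1) + r) (C.b (i + 1))) := by
  rcases h : C.letter (i + 1) with _ | γ | γ
  · rw [C.bPlus_of_not (by simp [h]), homVal_zero]; rfl
  · rw [C.bPlus_of_not (by simp [h]), homVal_zero]; rfl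
  · have h1 : C.mu (i + 1) = C.mu i + 1 := by rw [mu_add_one, letterDeg, h]; rfl
    have h2 : n = C.mu (i + 1) + r := by lia
    subst h2
    rw [C.bPlus_of h, homVal_smul]
    · rfl
    · exact C.b_mem (C.vert_of_letter h).2.2.1 (by lia)

theorem homVal_bMinus (n i : ℤ) (hi : C.mu i + 1 = n + -r) :
    homVal f n (C.bMinus i) = (C.letter i).elim 0 fun x =>
      x.flip.plus M (homVal f (C.mu (i - 1) + r) (C.b (i - 1))) := by
  rcases h : C.letter i with _ | γ | γ
  · rw [C.bMinus_of_not (by simp [h]), homVal_zero]; rfl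
  · have h0 := C.mu_add_one (i - 1)
    rw [sub_add_cancel, letterDeg, h] at h0
    have h1 : C.mu i = C.mu (i - 1) + -1 := h0
    have h2 : n = C.mu (i - 1) + r := by lia
    subst h2
    rw [C.bMinus_of h, homVal_smul]
    · rfl
    · exact C.b_mem (C.vert_of_letter h).2.2.2 (by lia)
  · rw [C.bMinus_of_not (by simp [h]), homVal_zero]; rfl

theorem bMinus_mem {i n : ℤ} (hi : C.mu i + 1 = n) : C.bMinus i ∈ C.piece n := by
  rcases h : C.letter i with _ | γ | γ
  · rw [C.bMinus_of_not (by simp [h])]; exact Submodule.zero_mem _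
  · have h0 := C.mu_add_one (i - 1)
    rw [sub_add_cancel, letterDeg, h] at h0
    have h1 : C.mu i = C.mu (i - 1) + -1 := h0
    rw [C.bMinus_of h]
    exact Submodule.smul_mem _ _ (C.b_mem (C.vert_of_letter h).2.2.2 (by lia))
  · rw [C.bMinus_of_not (by simp [h])]; exact Submodule.zero_mem _

theorem bPlus_mem {i n : ℤ} (hi : C.mu i + 1 = n) : C.bPlus i ∈ C.piece n := by
  have h := C.diff_b_mem rfl hi
  rw [diff_b] at h
  exact (Submodule.add_mem_iff_right _ (bMinus_mem hi)).1 h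

theorem e_smul_b (i : ℤ) : G.e (C.vert i) • C.b i = C.b i := by
  rw [b, Finsupp.smul_single, smul_eq_mul, triv_idem]

/-- The elements given by a morphism `P(C)[r] ⟶ M`. -/
theorem isDiffSeq_of_hom :
    IsDiffSeq M C fun i => C.twist r i • homVal f (C.mu i + r) (C.b i) := by
  have hb : ∀ i ∈ C.index, C.b i ∈ C.piece (C.mu i + r + -r) := fun i hi => C.b_mem hi (by lia)
  refine ⟨fun i hi => ?_, fun i hi => ?_⟩
  · change G.e (C.vert i) • _ = _
    rw [smul_comm, ← homVal_smul f _ (hb i hi), e_smul_b]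
  · beta_reduce
    -- Both sides become `(-1)^r` times the twist at `i` times the image of `b_i^- + b_i^+`: on one
    -- side from the shifted differential, on the other from the neighbouring twists.
    rw [C.elim_plus_twist r i (fun j => C.twist r j • homVal f (C.mu j + r) (C.b j)) _
      fun _ _ => rfl, map_zsmul, totalD_homVal f (hb i hi), diff_b,
      homVal_add f (bMinus_mem (by lia)) (bPlus_mem (by lia)), homVal_bPlus f _ _ (by lia),
      homVal_bMinus f _ _ (by lia), smul_smul, mul_comm]

theorem homVal_b_zero : C.twist r 0 • homVal f (C.mu 0 + r) (C.b 0) =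
    DirectSum.lof G.Alg ℤ (fun i => M.X i) r (f.f r (C.bShift r)) := by
  rw [twist_zero, one_smul, mu_zero, zero_add, bShift_eq, homVal_of_mem]

end HomVal

/-! ### From sequences to the subspaces `C M` -/

/-- With `γ = l(γ)λ`, the element `λa` serves as coefficient of `l(γ)`. A second term starting with
a different arrow of the same head does not disturb it. -/
theorem isArrowD_of_eq {γ : G.NzPath} {m a z : Total M} (hm : m ∈ vertexPart M γ.hd)
    (h : totalD M m = γ.val • a + z)
    (hz : z = 0 ∨ ∃ (ν : G.NzPath) (b : Total M), ν.hd = γ.hd ∧ ν.last ≠ γ.last ∧ z = ν.val • b) :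
    IsArrowD M γ.last m (γ.val • a) := by
  classical
  refine ⟨hm, ?_⟩
  have hsum : ∀ (ν : G.NzPath) (b : Total M), ν.hd = γ.hd →
      ν.val • b = ∑ β ∈ Finset.univ.filter (fun β => G.Q.hd β = G.Q.hd γ.last),
        G.ar β • (Pi.single ν.last (ν.rest • b) : A → Total M) β := by
    intro ν b hν
    rw [Finset.sum_eq_single ν.last, Pi.single_eq_same, smul_smul, ← NzPath.val_eq]
    · intro β _ hβ
      rw [Pi.single_eq_of_ne hβ, smul_zero]
    · exact fun h => absurd ((Finset.mem_filter (s := Finset.univ)).2 ⟨Finset.mem_univ ν.last, hν⟩) h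
  rcases hz with rfl | ⟨ν, b, hν, hne, rfl⟩
  · refine ⟨Pi.single γ.last (γ.rest • a), ?_, ?_⟩
    · rw [h, add_zero, hsum γ a rfl]
    · rw [Pi.single_eq_same, smul_smul, ← NzPath.val_eq]
  · refine ⟨Pi.single γ.last (γ.rest • a) + Pi.single ν.last (ν.rest • b), ?_, ?_⟩
    · rw [h, hsum γ a rfl, hsum ν b hν, ← Finset.sum_add_distrib]
      simp only [Pi.add_apply, smul_add]
    · rw [Pi.add_apply, Pi.single_eq_same, Pi.single_eq_of_ne (Ne.symm hne), add_zero, smul_smul,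
        ← NzPath.val_eq]

/-- The condition concerns the differential at the place where `γ` ends: `i` for `[γ]`, and `i - 1`
for `[γ⁻¹]`. The letter on the far side of that place contributes only in the orientation for which
adjacency demands a different last arrow. -/
theorem IsDiffSeq.rel {s : ℤ → Total M} (hs : IsDiffSeq M C s) {i : ℤ} {x : G.Letter}
    (hx : C.letter i = some x) : x.Rel M (s (i - 1)) (s i) := by
  obtain ⟨h1, h2, h3, h4⟩ := C.vert_of_letter hx
  have hv1 := hs.1 i h3
  have hv2 := hs.1 (i - 1) h4
  rw [h1] at hv1
  rw [h2] at hv2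
  rcases x with γ | γ
  · have hd := hs.2 i h3
    rw [hx] at hd
    refine ⟨hv2, isArrowD_of_eq hv1 hd ?_⟩
    rcases hy : C.letter (i + 1) with _ | μ | μ
    · exact Or.inl rfl
    · exact Or.inl rfl
    · have hadj := C.adj i _ _ hx hy
      exact Or.inr ⟨μ, s (i + 1), hadj.1.symm, hadj.2.symm, rfl⟩
  · have hd := hs.2 (i - 1) h4
    rw [sub_add_cancel, hx, add_comm] at hd
    refine ⟨isArrowD_of_eq hv2 hd ?_, hv1⟩
    rcases hy : C.letter (i - 1) with _ | μ | μ
    · exact Or.inl rfl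
    · have hadj := C.adj (i - 1) _ _ hy (by rwa [sub_add_cancel])
      exact Or.inr ⟨μ, s (i - 1 - 1), hadj.1, hadj.2, rfl⟩
    · exact Or.inl rfl

end GWord

theorem mem_foldr_act {u : V} : ∀ (L : List G.Letter) (s : ℕ → Total M),
    (∀ (n : ℕ) (x : G.Letter), L[n]? = some x → x.Rel M (s n) (s (n + 1))) → s L.length ∈ vertexPart M u →
      s 0 ∈ L.foldr (fun x U => x.act M U) (vertexPart M u)
  | [], _, _, hu => hu
  | x :: L, s, h, hu => (h 0 x rfl).mem_act
      (mem_foldr_act L (fun n => s (n + 1)) (fun n y hy => h (n + 1) y (by simpa using hy)) hu)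

/-- The relations at the letters `1, …, t` alone are the witnesses required by `CM`; the extension
of the word plays no part once they are known. -/
theorem FinWord.mem_act_of_isDiffSeq {v : V} {δ : ℤˣ} (C : G.FinWord v δ) {s : ℤ → Total M}
    (hs : GWord.IsDiffSeq M C.ext s) : s 0 ∈ C.act M := by
  have hlet : ∀ (n : ℕ) x, C.letters[n]? = some x → C.ext.letter ((n : ℤ) + 1) = some x := by
    intro n x hx
    obtain ⟨hn, hx⟩ := List.getElem?_eq_some_iff.1 hx
    rw [C.ext_letter_pos (by lia), show ((n : ℤ) + 1 - 1).toNat = n by lia, C.right_of_lt hn, hx]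
  have hrel : ∀ (n : ℕ) x, C.letters[n]? = some x → x.Rel M (s n) (s ((n + 1 : ℕ) : ℤ)) := by
    intro n x hx
    have := hs.rel (hlet n x hx)
    rwa [add_sub_cancel_right] at this
  refine mem_foldr_act C.letters (fun n => s n) hrel ?_
  rcases hl : C.letters.getLast? with _ | x
  · have h0 : C.letters = [] := List.getLast?_eq_none_iff.1 hl
    have := hs.1 0 C.ext.zero_mem_index
    simp only [h0, endVert]
    exact this
  · have hx := hl
    rw [List.getLast?_eq_getElem?] at hx
    have hpos : 0 < C.letters.length := by
      obtain ⟨hn, -⟩ := List.getElem?_eq_some_iff.1 hx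
      lia
    have := (hrel _ x hx).mem_tl
    rw [Nat.sub_add_cancel hpos] at this
    simp only [endVert, hl]
    exact this

end Morphisms

/-! ### Base points, fullness of the homotopy functor, and the conclusion -/

section CompactMap

variable {k V A : Type u} [Field k] [Fintype V] [Fintype A] {G : GentleData k V A}
variable {v : V} {δ : ℤˣ} (C : G.FinWord v δ)

/-- The place `0` belongs to the part on which `a⟨C⟩` is the identity, for every `C`. The proof of
the theorem uses nothing else about the values of `a⟨C⟩`. -/
theorem FinWord.compactMap_bShift (r : ℤ) :
    ((degShift (G := G) r).map C.compactMap).f r ((triv G v δ).bShift r) = C.ext.bShift r := by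
  rw [GWord.bShift_eq, GWord.bShift_eq]
  refine Subtype.ext ?_
  change C.aLin ((triv G v δ).b 0) = C.ext.b 0
  rw [aLin_b, aVal_flat]
  exact C.flat_of_le le_rfl (GWord.zero_mem_index _)

end CompactMap

/-- Fullness lifts each `φ` to a morphism `f`, and then `φ ∘ F(a)` is the image of `f ∘ a`. -/
theorem ppSubgroup_map {T T' : Type*} [Category T] [Preadditive T] [Category T'] [Preadditive T']
    (F : T ⥤ T') [F.Additive] [F.Full] {X Y : T} (a : X ⟶ Y) (M : T) :
    ppSubgroup (F.map a) (F.obj M) = (ppSubgroup a M).map F.mapAddHom := by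
  ext g
  constructor
  · rintro ⟨φ, rfl⟩
    obtain ⟨f, rfl⟩ := F.map_surjective φ
    exact ⟨a ≫ f, ⟨f, rfl⟩, F.map_comp a f⟩
  · rintro ⟨_, ⟨f, rfl⟩, rfl⟩
    exact ⟨F.map f, (F.map_comp a f).symm⟩

end GentleData

end

theorem lemma5 {k V A : Type u} [Field k] [Fintype V] [Fintype A] (G : GentleData k V A)
    (M : CochainComplex (ModuleCat.{u} G.Alg) ℤ) (hM : GentleData.IsMinimalProj M)
    (v : V) (δ : ℤˣ) (C : G.FinWord v δ) (r : ℤ) :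
    {m : M.X r | G.e v • m = m ∧ DirectSum.lof G.Alg ℤ (fun i => M.X i) r m ∈ C.act M} =
      {m : M.X r | ∃ g ∈ GentleData.ppSubgroup ((GentleData.degShift r).map C.compactMap) M,
        m = g.f r (GentleData.GWord.bShift (GentleData.FinWord.triv G v δ) r)} ∧
    GentleData.ppSubgroup
        (GentleData.toK.map ((GentleData.degShift r).map C.compactMap)) (GentleData.toK.obj M) =
      (GentleData.ppSubgroup ((GentleData.degShift r).map C.compactMap) M).map
        GentleData.toK.mapAddHom := by
  have hval : ∀ f : (GentleData.degShift (G := G) r).obj C.ext.complex ⟶ M,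
      ((GentleData.degShift r).map C.compactMap ≫ f).f r
        (GentleData.GWord.bShift (GentleData.FinWord.triv G v δ) r) =
      f.f r (C.ext.bShift r) := fun f => congrArg (f.f r) (C.compactMap_bShift r)
  refine ⟨Set.Subset.antisymm ?_ ?_, GentleData.ppSubgroup_map _ _ _⟩
  · rintro m ⟨-, hm⟩
    obtain ⟨s, hs0, hs⟩ := C.exists_sequence hM hm
    obtain ⟨f, hf⟩ := GentleData.GWord.IsDiffSeq.exists_hom hs r
    refine ⟨_, ⟨f, rfl⟩, ?_⟩
    refine Eq.trans ?_ (hval f).symm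
    -- The value at `b_0` is the degree `r` component of `s_0`, which is `m` itself as `m` is
    -- homogeneous of degree `r`.
    rw [hf, hs0, DirectSum.component.lof_self]
  · rintro _ ⟨_, ⟨f, rfl⟩, rfl⟩
    have hs := GentleData.GWord.isDiffSeq_of_hom f
    have h0 := C.mem_act_of_isDiffSeq hs
    rw [GentleData.GWord.homVal_b_zero f] at h0
    have hv := hs.1 0 C.ext.zero_mem_index
    beta_reduce at hv
    rw [GentleData.GWord.homVal_b_zero f] at hv
    refine (show _ ∧ _ from ⟨?_, ?_⟩)
    · refine ((congrArg (G.e v • ·) (hval f)).trans ?_).trans (hval f).symm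
      -- Membership in `e_v M` is known in `⊕ M^i`; its component in degree `r` is the assertion in
      -- `M^r`.
      have := congrArg (DirectSum.component G.Alg ℤ (fun i => M.X i) r)
        (show G.e v • _ = _ from hv)
      rwa [map_smul, DirectSum.component.lof_self] at this
    · refine (congrArg (· ∈ C.act M) (congrArg _ (hval f))).mpr h0
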